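/- Let $\mathfrak{sl}_2=\mathfrak{sl}_2(\mathbb{C})$ with basis $e,h,f$ ($[h,e]=2e$, $[e,f]=h$, $[h,f]=-2f$) and invariant form $\kappa(x,y)=\operatorname{tr}(xy)$. Let $\omega$ be the fundamental weight, $\alpha=2\omega$ the simple root, and $(\cdot,\cdot)$ the form on weights with $(\alpha,\alpha)=2$. Let $$\widehat{\mathfrak{sl}}_2=\mathfrak{sl}_2\otimes\mathbb{C}[t,t^{-1}]\oplus\mathbb{C}K\oplus\mathbb{C}L_0,$$ where $x_n=x\otimes t^n$, $K$ is central, $[x_m,y_n]=[x,y]_{m+n}+m\,\delta_{m+n,0}\,\kappa(x,y)K$ and $[L_0,x_n]=-n\,x_n$. An $\mathfrak{sl}_2$-module $M$ is extended to the subalgebra spanned by $K$, $L_0$ and all $x_n$ with $n\ge 0$ by letting $K$ act as $\mathsf{k}$, $L_0$ as $\Delta$, $x_0$ as $x$, and $x_n$ as $0$ for $n>0$. Inducing from this subalgebra to $\widehat{\mathfrak{sl}}_2$ gives the relaxed Verma module of level $\mathsf{k}$ and conformal weight $\Delta$ associated with $M$. For a weight $\lambda$ and $q\in\mathbb{C}$,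 let $\mathcal{D}_{\lambda;q}$ be the $\mathfrak{sl}_2$-module with basis $v_\mu$, $\mu\in\lambda+\mathbb{Z}\alpha$, and action $$e v_\mu=\tfrac12\bigl(q-(\mu,\mu+\alpha)\bigr)v_{\mu+\alpha},\qquad h v_\mu=(\mu,\alpha)v_\mu,\qquad f v_\mu=v_{\mu-\alpha}.$$ Let $\mathcal{E}_{\lambda;q}$ be the quotient of the relaxed Verma module associated with $\mathcal{D}_{\lambda;q}$ by the sum of its submodules that have zero intersection with the space of ground states, that is, of generalised $L_0$-eigenvectors of minimal $L_0$-eigenvalue. Let $\mathcal{L}^+_\mu$ (respectively $\mathcal{L}^-_\mu$) be the simple quotient of the relaxed Verma module associated with the $\mathfrak{sl}_2$ Verma module of highest weight $\mu$ (respectively lowest weight $\mu$). **Theorem.** Let $u\ge 2$ and $v\ge 1$ be coprime integers, let $\mathsf{k}=\frac uv-2$, and let $1\le r\le u-1$ and $1\le s\le v-1$. Put $$\mu_{r,s}=\Bigl(r-1-\frac uv s\Bigr)\omega,\qquad q_{r,s}=\frac{(vr-us)^2-v^2}{2v^2},\qquad \Delta=\frac{q_{r,s}}{2(\mathsf{k}+2)}.$$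 At level $\mathsf{k}$, with the generating vectors (ground states) of all three modules below of conformal weight $\Delta$, the $\widehat{\mathfrak{sl}}_2$-module $\mathcal{E}_{\mu_{r,s};q_{r,s}}$ is a non-split extension of the simple module $\mathcal{L}^-_{\mu_{r,s}+\alpha}=\mathcal{L}^-_{-\mu_{u-r,v-s}}$ by the simple highest-weight module $\mathcal{L}^+_{\mu_{r,s}}$: one has $\mu_{r,s}+\alpha=-\mu_{u-r,v-s}$, and there is a short exact sequence of $\widehat{\mathfrak{sl}}_2$-modules $$0\longrightarrow\mathcal{L}^+_{\mu_{r,s}}\longrightarrow\mathcal{E}_{\mu_{r,s};q_{r,s}}\longrightarrow\mathcal{L}^-_{-\mu_{u-r,v-s}}\longrightarrow 0$$ which does not split. -/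

import Mathlib

open scoped TensorProduct

noncomputable section

namespace RelaxedSl2

/-! ## The Lie algebra `sl₂` and the affine Kac-Moody algebra -/

/-- The simple Lie algebra `sl₂` over the complex numbers (traceless `2 × 2` matrices). -/
abbrev Sl2 : Type := LieAlgebra.SpecialLinear.sl (Fin 2) ℂ

/-- The rescaled Killing form `κ(x, y) = tr (x y)` on `sl₂`, for which `κ(h, h) = 2` and
`κ(e, f) = κ(f, e) = 1`. -/
def killing : Sl2 →ₗ[ℂ] Sl2 →ₗ[ℂ] ℂ :=
  LinearMap.mk₂ ℂ (fun x y => Matrix.trace (x.1 * y.1))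
    (fun x y z => by simp [add_mul])
    (fun c x y => by simp)
    (fun x y z => by simp [mul_add])
    (fun c x y => by simp)

theorem killing_apply (x y : Sl2) : killing x y = Matrix.trace (x.1 * y.1) := rfl

theorem killing_symm (x y : Sl2) : killing x y = killing y x :=
  Matrix.trace_mul_comm x.1 y.1

theorem killing_lie (x y z : Sl2) : killing ⁅x, y⁆ z = killing x ⁅y, z⁆ := by
  have h : Matrix.trace (y.1 * (x.1 * z.1)) = Matrix.trace (x.1 * (z.1 * y.1)) := by
    rw [Matrix.trace_mul_comm, mul_assoc]
  simp only [killing_apply, LieAlgebra.SpecialLinear.sl_bracket, sub_mul, mul_sub,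
    Matrix.trace_sub, mul_assoc, h]

/-- The space `sl₂ ⊗ ℂ[t, t⁻¹]`, with `x ⊗ tⁿ` written `Finsupp.single n x`. -/
abbrev Loop : Type := ℤ →₀ Sl2

/-- The loop bracket `[x ⊗ tᵐ, y ⊗ tⁿ] = [x, y] ⊗ tᵐ⁺ⁿ`. -/
def loopBracket : Loop →ₗ[ℂ] Loop →ₗ[ℂ] Loop :=
  Finsupp.lsum ℂ fun m : ℤ => LinearMap.flip <| Finsupp.lsum ℂ fun n : ℤ =>
    LinearMap.flip <| (LieModule.toEnd ℂ Sl2 Sl2 : Sl2 →ₗ[ℂ] Module.End ℂ Sl2).compr₂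
      (Finsupp.lsingle (m + n))

/-- The degree derivation `x ⊗ tⁿ ↦ n x ⊗ tⁿ`. -/
def loopDeg : Loop →ₗ[ℂ] Loop := Finsupp.lsum ℂ fun n : ℤ => (n : ℂ) • Finsupp.lsingle n

/-- The cocycle `(x ⊗ tᵐ, y ⊗ tⁿ) ↦ m δ_{m+n,0} κ(x, y)`. -/
def loopCocycle : Loop →ₗ[ℂ] Loop →ₗ[ℂ] ℂ :=
  Finsupp.lsum ℂ fun m : ℤ => LinearMap.flip <| Finsupp.lsum ℂ fun n : ℤ =>
    LinearMap.flip <| (if m + n = 0 then (m : ℂ) else 0) • killing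

theorem loopBracket_single (m n : ℤ) (x y : Sl2) :
    loopBracket (Finsupp.single m x) (Finsupp.single n y) = Finsupp.single (m + n) ⁅x, y⁆ := by
  simp [loopBracket]

theorem loopDeg_single (n : ℤ) (x : Sl2) :
    loopDeg (Finsupp.single n x) = (n : ℂ) • Finsupp.single n x := by
  simp [loopDeg]

theorem loopCocycle_single (m n : ℤ) (x y : Sl2) :
    loopCocycle (Finsupp.single m x) (Finsupp.single n y) =
      if m + n = 0 then (m : ℂ) * killing x y else 0 := by
  simp only [loopCocycle, Finsupp.lsum_single, LinearMap.flip_apply, LinearMap.smul_apply,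
    smul_eq_mul, ite_mul, zero_mul]

theorem loopBracket_skew (a b : Loop) : loopBracket a b = -loopBracket b a := by
  induction a using Finsupp.induction_linear with
  | zero => simp
  | add a a' h h' => simp only [map_add, LinearMap.add_apply, h, h', neg_add]
  | single m x =>
    induction b using Finsupp.induction_linear with
    | zero => simp
    | add b b' h h' => simp only [map_add, LinearMap.add_apply, h, h', neg_add]
    | single n y =>
      rw [loopBracket_single, loopBracket_single, add_comm n m, ← lie_skew, Finsupp.single_neg]

theorem loopBracket_self (a : Loop) : loopBracket a a = 0 := by
  have h : (2 : ℂ) • loopBracket a a = 0 := by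
    rw [two_smul, ← eq_neg_iff_add_eq_zero]; exact loopBracket_skew a a
  exact (smul_eq_zero.mp h).resolve_left two_ne_zero

theorem loopBracket_jacobi (a b c : Loop) :
    loopBracket a (loopBracket b c) =
      loopBracket (loopBracket a b) c + loopBracket b (loopBracket a c) := by
  induction a using Finsupp.induction_linear with
  | zero => simp
  | add a a' h h' => simp only [map_add, LinearMap.add_apply, h, h']; abel
  | single m x =>
    induction b using Finsupp.induction_linear with
    | zero => simp
    | add b b' h h' => simp only [map_add, LinearMap.add_apply, h, h']; abel
    | single n y =>
      induction c using Finsupp.induction_linear with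
      | zero => simp
      | add c c' h h' => simp only [map_add, h, h']; abel
      | single p z =>
        simp only [loopBracket_single]
        rw [← add_assoc, show n + (m + p) = m + n + p by ring, ← Finsupp.single_add,
          leibniz_lie]

theorem loopDeg_bracket (a b : Loop) :
    loopDeg (loopBracket a b) = loopBracket (loopDeg a) b + loopBracket a (loopDeg b) := by
  induction a using Finsupp.induction_linear with
  | zero => simp
  | add a a' h h' => simp only [map_add, LinearMap.add_apply, h, h']; abel
  | single m x =>
    induction b using Finsupp.induction_linear with
    | zero => simp
    | add b b' h h' => simp only [map_add, h, h']; abel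
    | single n y =>
      simp only [loopBracket_single, loopDeg_single, map_smul, LinearMap.smul_apply,
        ← add_smul, Int.cast_add]

theorem loopCocycle_skew (a b : Loop) : loopCocycle a b = -loopCocycle b a := by
  induction a using Finsupp.induction_linear with
  | zero => simp
  | add a a' h h' => simp only [map_add, LinearMap.add_apply, h, h', neg_add]
  | single m x =>
    induction b using Finsupp.induction_linear with
    | zero => simp
    | add b b' h h' => simp only [map_add, LinearMap.add_apply, h, h', neg_add]
    | single n y =>
      rw [loopCocycle_single, loopCocycle_single, add_comm n m, killing_symm y x]
      split_ifs with h
      · rw [show n = -m by omega]; push_cast; ring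
      · simp

theorem loopCocycle_self (a : Loop) : loopCocycle a a = 0 :=
  self_eq_neg.mp (loopCocycle_skew a a)

theorem loopCocycle_deg (a b : Loop) :
    loopCocycle (loopDeg a) b + loopCocycle a (loopDeg b) = 0 := by
  induction a using Finsupp.induction_linear with
  | zero => simp
  | add a a' h h' =>
    simp only [map_add, LinearMap.add_apply]
    rw [add_add_add_comm, h, h', add_zero]
  | single m x =>
    induction b using Finsupp.induction_linear with
    | zero => simp
    | add b b' h h' =>
      simp only [map_add]
      rw [add_add_add_comm, h, h', add_zero]
    | single n y =>
      simp only [loopDeg_single, map_smul, LinearMap.smul_apply, smul_eq_mul, ← add_mul,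
        loopCocycle_single]
      split_ifs with h
      · rw [show n = -m by omega]; simp
      · simp

theorem loopCocycle_jacobi (a b c : Loop) :
    loopCocycle a (loopBracket b c) =
      loopCocycle (loopBracket a b) c + loopCocycle b (loopBracket a c) := by
  induction a using Finsupp.induction_linear with
  | zero => simp
  | add a a' h h' => simp only [map_add, LinearMap.add_apply, h, h']; abel
  | single m x =>
    induction b using Finsupp.induction_linear with
    | zero => simp
    | add b b' h h' => simp only [map_add, LinearMap.add_apply, h, h']; abel
    | single n y =>
      induction c using Finsupp.induction_linear with
      | zero => simp
      | add c c' h h' => simp only [map_add, h, h']; abel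
      | single p z =>
        simp only [loopBracket_single, loopCocycle_single]
        rw [← add_assoc, show n + (m + p) = m + n + p by ring]
        have h1 : killing y ⁅x, z⁆ = -killing x ⁅y, z⁆ := by
          rw [← killing_lie, ← killing_lie, ← lie_skew, map_neg, LinearMap.neg_apply]
        split_ifs with h
        · rw [killing_lie, h1]; push_cast; ring
        · simp

/-- The untwisted affine Kac-Moody algebra `sl₂ ⊗ ℂ[t, t⁻¹] ⊕ ℂ K ⊕ ℂ L₀`: the three components
are the loop part and the coefficients of `K` and of `L₀`. -/
@[ext] structure AffineSl2 : Type where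
  /-- the component in `sl₂ ⊗ ℂ[t, t⁻¹]` -/
  loop : Loop
  /-- the coefficient of `K` -/
  cK : ℂ
  /-- the coefficient of `L₀` -/
  cL : ℂ

namespace AffineSl2

/-- The underlying vector space of the affine algebra. -/
def toProd : AffineSl2 ≃ Loop × ℂ × ℂ where
  toFun a := (a.loop, a.cK, a.cL)
  invFun p := ⟨p.1, p.2.1, p.2.2⟩
  left_inv _ := rfl
  right_inv _ := rfl

instance : AddCommGroup AffineSl2 := toProd.addCommGroup

instance : Module ℂ AffineSl2 := toProd.module ℂ

/-- `K` is central, `[L₀, x ⊗ tⁿ] = -n x ⊗ tⁿ`, and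
`[x ⊗ tᵐ, y ⊗ tⁿ] = [x, y] ⊗ tᵐ⁺ⁿ + m δ_{m+n,0} κ(x, y) K`. -/
instance : Bracket AffineSl2 AffineSl2 where
  bracket a b := ⟨loopBracket a.loop b.loop - a.cL • loopDeg b.loop + b.cL • loopDeg a.loop,
    loopCocycle a.loop b.loop, 0⟩

@[simp] theorem loop_zero : (0 : AffineSl2).loop = 0 := rfl
@[simp] theorem cK_zero : (0 : AffineSl2).cK = 0 := rfl
@[simp] theorem cL_zero : (0 : AffineSl2).cL = 0 := rfl
@[simp] theorem loop_add (a b : AffineSl2) : (a + b).loop = a.loop + b.loop := rfl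
@[simp] theorem cK_add (a b : AffineSl2) : (a + b).cK = a.cK + b.cK := rfl
@[simp] theorem cL_add (a b : AffineSl2) : (a + b).cL = a.cL + b.cL := rfl
@[simp] theorem loop_smul (c : ℂ) (a : AffineSl2) : (c • a).loop = c • a.loop := rfl
@[simp] theorem cK_smul (c : ℂ) (a : AffineSl2) : (c • a).cK = c • a.cK := rfl
@[simp] theorem cL_smul (c : ℂ) (a : AffineSl2) : (c • a).cL = c • a.cL := rfl
@[simp] theorem loop_neg (a : AffineSl2) : (-a).loop = -a.loop := rfl
@[simp] theorem cK_neg (a : AffineSl2) : (-a).cK = -a.cK := rfl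
@[simp] theorem cL_neg (a : AffineSl2) : (-a).cL = -a.cL := rfl
@[simp] theorem loop_lie (a b : AffineSl2) : ⁅a, b⁆.loop =
    loopBracket a.loop b.loop - a.cL • loopDeg b.loop + b.cL • loopDeg a.loop := rfl
@[simp] theorem cK_lie (a b : AffineSl2) : ⁅a, b⁆.cK = loopCocycle a.loop b.loop := rfl
@[simp] theorem cL_lie (a b : AffineSl2) : ⁅a, b⁆.cL = 0 := rfl

instance : LieRing AffineSl2 where
  add_lie a b c := by
    ext1
    · simp only [loop_lie, loop_add, cL_add, map_add, LinearMap.add_apply, add_smul, smul_add]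
      abel
    · simp
    · simp
  lie_add a b c := by
    ext1
    · simp only [loop_lie, loop_add, cL_add, map_add, add_smul, smul_add]
      abel
    · simp
    · simp
  lie_self a := by
    ext1
    · simp [loopBracket_self]
    · simp [loopCocycle_self]
    · simp
  leibniz_lie a b c := by
    ext1
    · simp only [loop_lie, loop_add, cL_lie, map_add, map_sub, map_smul, LinearMap.add_apply,
        LinearMap.sub_apply, LinearMap.smul_apply, smul_add, smul_sub, zero_smul,
        loopDeg_bracket, loopBracket_jacobi a.loop b.loop c.loop,
        loopBracket_skew b.loop (loopDeg a.loop), smul_neg, smul_comm b.cL a.cL,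
        smul_comm c.cL a.cL, smul_comm c.cL b.cL]
      abel
    · have h1 := loopCocycle_deg a.loop c.loop
      have h2 := loopCocycle_deg a.loop b.loop
      have h3 := loopCocycle_deg b.loop c.loop
      have h4 := loopCocycle_skew b.loop (loopDeg a.loop)
      simp only [cK_lie, cK_add, loop_lie, map_add, map_sub, map_smul, LinearMap.add_apply,
        LinearMap.sub_apply, LinearMap.smul_apply, smul_eq_mul,
        loopCocycle_jacobi a.loop b.loop c.loop]
      linear_combination (-b.cL) * h1 + c.cL * h2 + a.cL * h3 - c.cL * h4
    · simp

instance : LieAlgebra ℂ AffineSl2 where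
  lie_smul t a b := by
    ext1
    · simp only [loop_lie, loop_smul, cL_smul, map_smul, smul_add, smul_sub, smul_eq_mul,
        mul_smul, smul_comm a.cL t]
    · simp
    · simp

/-- The mode `x_n = x ⊗ tⁿ`. -/
def mode (n : ℤ) (x : Sl2) : AffineSl2 := ⟨Finsupp.single n x, 0, 0⟩

/-- The central element `K`. -/
def K : AffineSl2 := ⟨0, 1, 0⟩

/-- The derivation `L₀`. -/
def L0 : AffineSl2 := ⟨0, 0, 1⟩

theorem mode_lie_mode (m n : ℤ) (x y : Sl2) :
    ⁅mode m x, mode n y⁆ =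
      mode (m + n) ⁅x, y⁆ + (if m + n = 0 then (m : ℂ) * killing x y else 0) • K := by
  split_ifs with h <;> ext1 <;> simp [mode, K, loopBracket_single, loopCocycle_single, h]

theorem L0_lie_mode (n : ℤ) (x : Sl2) : ⁅L0, mode n x⁆ = -(n : ℂ) • mode n x := by
  ext1 <;> simp [mode, L0, loopDeg_single]

theorem K_lie (a : AffineSl2) : ⁅K, a⁆ = 0 := by
  ext1 <;> simp [K]

end AffineSl2

/-! ## Weight modules over `sl₂`

A weight `μ` of `sl₂` is identified with its Dynkin label: `c : ℂ` stands for `c ω`, with `ω` the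
fundamental weight; so the simple root is `2` and the Weyl vector is `1`. -/

/-- The bilinear form on weights normalised so that the simple root has square length `2`. -/
def bilin (a b : ℂ) : ℂ := a * b / 2

/-- Three operators on `V` that satisfy the relations of `e`, `h`, `f`, that is, a representation
of `sl₂` on `V`. -/
structure Sl2Rep (V : Type) [AddCommGroup V] [Module ℂ V] : Type where
  /-- the operator by which `e` acts -/
  E : Module.End ℂ V
  /-- the operator by which `h` acts -/
  H : Module.End ℂ V
  /-- the operator by which `f` acts -/
  F : Module.End ℂ V
  hHE : H * E - E * H = (2 : ℂ) • E
  hEF : E * F - F * E = H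
  hHF : H * F - F * H = -((2 : ℂ) • F)

namespace Sl2Rep

variable {V : Type} [AddCommGroup V] [Module ℂ V]

/-- The operator by which `x ∈ sl₂` acts; as a matrix `x` is `x₀₁ e + x₀₀ h + x₁₀ f`. -/
def act (T : Sl2Rep V) (x : Sl2) : Module.End ℂ V := x.1 0 1 • T.E + x.1 0 0 • T.H + x.1 1 0 • T.F

theorem act_lie (T : Sl2Rep V) (x y : Sl2) :
    T.act ⁅x, y⁆ = T.act x * T.act y - T.act y * T.act x := by
  have tr (z : Sl2) : z.1 1 1 = -z.1 0 0 := by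
    have h : Matrix.trace z.1 = 0 := LinearMap.mem_ker.mp z.2
    rw [Matrix.trace_fin_two] at h
    linear_combination h
  have hHE' : T.H * T.E = T.E * T.H + (2 : ℂ) • T.E := by rw [← T.hHE]; abel
  have hFE' : T.F * T.E = T.E * T.F - T.H := by rw [← T.hEF]; abel
  have hHF' : T.F * T.H = T.H * T.F + (2 : ℂ) • T.F := by
    rw [eq_add_of_sub_eq T.hHF]; abel
  simp only [act, LieAlgebra.SpecialLinear.sl_bracket, Matrix.sub_apply, Matrix.mul_apply,
    Fin.sum_univ_two, tr, add_mul, mul_add, smul_mul_smul_comm, hHE', hFE', hHF']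
  module

/-- The space `V` with the `sl₂`-module structure given by `T`. -/
@[nolint unusedArguments]
def Mod (_ : Sl2Rep V) : Type := V

variable (T : Sl2Rep V)

instance : AddCommGroup T.Mod := inferInstanceAs (AddCommGroup V)

instance : Module ℂ T.Mod := inferInstanceAs (Module ℂ V)

/-- The vector `v`, viewed in the `sl₂`-module. -/
def toMod : V ≃ₗ[ℂ] T.Mod := LinearEquiv.refl ℂ V

instance : LieRingModule Sl2 T.Mod where
  bracket x v := T.toMod (T.act x (T.toMod.symm v))
  add_lie x y v := by
    rw [← map_add, ← LinearMap.add_apply]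
    congr 2
    simp [act, add_smul]; abel
  lie_add x v w := by rw [map_add, map_add, map_add]
  leibniz_lie x y v := by
    rw [act_lie, ← map_add]
    simp

theorem lie_def (x : Sl2) (v : T.Mod) : ⁅x, v⁆ = T.toMod (T.act x (T.toMod.symm v)) := rfl

instance : LieModule ℂ Sl2 T.Mod where
  smul_lie c x v := by
    rw [lie_def, lie_def, ← map_smul, ← LinearMap.smul_apply]
    congr 2
    simp [act, mul_smul]
  lie_smul c x v := by rw [lie_def, lie_def, map_smul, map_smul, map_smul]

end Sl2Rep

/-- The linear map `v_n ↦ c n v_{σ n}` on the space with basis `v_n`. -/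
def shiftEnd {I : Type} (σ : I → I) (c : I → ℂ) : Module.End ℂ (I →₀ ℂ) :=
  Finsupp.lsum ℂ fun n => c n • Finsupp.lsingle (σ n)

theorem shiftEnd_single {I : Type} (σ : I → I) (c : I → ℂ) (n : I) (t : ℂ) :
    shiftEnd σ c (Finsupp.single n t) = Finsupp.single (σ n) (c n * t) := by
  simp [shiftEnd]

/-- The coefficient `γ_μ = (q - (μ, μ + 2ρ)) / 2`. -/
def gamma (q μ : ℂ) : ℂ := (q - bilin μ (μ + 2)) / 2

/-- The action of `sl₂` on the dense module with weight support `[lam] = {lam + 2 n | n ∈ ℤ}` and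
Casimir eigenvalue `q`, chosen so that `f` acts injectively. On the basis `v_μ`, `μ = lam + 2 n`,
which is `Finsupp.single n 1`: `e v_μ = γ_μ v_{μ+α}`, `h v_μ = (μ, α) v_μ`, `f v_μ = v_{μ-α}`. -/
def denseRep (lam q : ℂ) : Sl2Rep (ℤ →₀ ℂ) where
  E := shiftEnd (fun n => n + 1) fun n => gamma q (lam + 2 * n)
  H := shiftEnd (fun n => n) fun n => bilin (lam + 2 * n) 2
  F := shiftEnd (fun n => n - 1) fun _ => 1
  hHE := by
    refine Finsupp.lhom_ext fun n t => ?_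
    simp only [LinearMap.sub_apply, Module.End.mul_apply, LinearMap.smul_apply, shiftEnd_single,
      ← Finsupp.single_sub, Finsupp.smul_single, smul_eq_mul]
    congr 1
    simp only [bilin]; push_cast; ring
  hEF := by
    refine Finsupp.lhom_ext fun n t => ?_
    simp only [LinearMap.sub_apply, Module.End.mul_apply, shiftEnd_single,
      sub_add_cancel, add_sub_cancel_right, ← Finsupp.single_sub]
    congr 1
    simp only [gamma, bilin]; push_cast; ring
  hHF := by
    refine Finsupp.lhom_ext fun n t => ?_
    simp only [LinearMap.sub_apply, Module.End.mul_apply, LinearMap.smul_apply,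
      LinearMap.neg_apply, shiftEnd_single,
      ← Finsupp.single_sub, ← Finsupp.single_neg, Finsupp.smul_single, smul_eq_mul]
    congr 1
    simp only [bilin]; push_cast; ring

/-- The dense `sl₂`-module with support `[lam]` and Casimir eigenvalue `q`. -/
abbrev Dense (lam q : ℂ) : Type := (denseRep lam q).Mod

/-- The action of `sl₂` on the Verma module of highest weight `μ`. On its basis `v_n = fⁿ v_0`,
`n ≥ 0`: `e v_n = n (μ - n + 1) v_{n-1}`, `h v_n = (μ - 2 n) v_n`, `f v_n = v_{n+1}`. -/
def vermaPlusRep (μ : ℂ) : Sl2Rep (ℕ →₀ ℂ) where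
  E := shiftEnd (fun n => n - 1) fun n => n * (μ - n + 1)
  H := shiftEnd (fun n => n) fun n => μ - 2 * n
  F := shiftEnd (fun n => n + 1) fun _ => 1
  hHE := by
    refine Finsupp.lhom_ext fun n t => ?_
    simp only [LinearMap.sub_apply, Module.End.mul_apply, LinearMap.smul_apply, shiftEnd_single,
      ← Finsupp.single_sub, Finsupp.smul_single, smul_eq_mul]
    congr 1
    rcases n with _ | n
    · simp
    · simp only [Nat.add_sub_cancel]; push_cast; ring
  hEF := by
    refine Finsupp.lhom_ext fun n t => ?_
    simp only [LinearMap.sub_apply, Module.End.mul_apply, shiftEnd_single]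
    rcases n with _ | n
    · simp
    · simp only [Nat.add_sub_cancel, ← Finsupp.single_sub]
      congr 1
      push_cast; ring
  hHF := by
    refine Finsupp.lhom_ext fun n t => ?_
    simp only [LinearMap.sub_apply, Module.End.mul_apply, LinearMap.smul_apply,
      LinearMap.neg_apply, shiftEnd_single,
      ← Finsupp.single_sub, ← Finsupp.single_neg, Finsupp.smul_single, smul_eq_mul]
    congr 1
    push_cast; ring

/-- The `sl₂` Verma module of highest weight `μ`. -/
abbrev VermaPlus (μ : ℂ) : Type := (vermaPlusRep μ).Mod

/-- The action of `sl₂` on the Verma module of lowest weight `μ`. On its basis `v_n = eⁿ v_0`,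
`n ≥ 0`: `e v_n = v_{n+1}`, `h v_n = (μ + 2 n) v_n`, `f v_n = -n (μ + n - 1) v_{n-1}`. -/
def vermaMinusRep (μ : ℂ) : Sl2Rep (ℕ →₀ ℂ) where
  E := shiftEnd (fun n => n + 1) fun _ => 1
  H := shiftEnd (fun n => n) fun n => μ + 2 * n
  F := shiftEnd (fun n => n - 1) fun n => -n * (μ + n - 1)
  hHE := by
    refine Finsupp.lhom_ext fun n t => ?_
    simp only [LinearMap.sub_apply, Module.End.mul_apply, LinearMap.smul_apply, shiftEnd_single,
      ← Finsupp.single_sub, Finsupp.smul_single, smul_eq_mul]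
    congr 1
    push_cast; ring
  hEF := by
    refine Finsupp.lhom_ext fun n t => ?_
    simp only [LinearMap.sub_apply, Module.End.mul_apply, shiftEnd_single]
    rcases n with _ | n
    · simp
    · simp only [Nat.add_sub_cancel, ← Finsupp.single_sub]
      congr 1
      push_cast; ring
  hHF := by
    refine Finsupp.lhom_ext fun n t => ?_
    simp only [LinearMap.sub_apply, Module.End.mul_apply, LinearMap.smul_apply,
      LinearMap.neg_apply, shiftEnd_single,
      ← Finsupp.single_sub, ← Finsupp.single_neg, Finsupp.smul_single, smul_eq_mul]
    congr 1
    rcases n with _ | n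
    · simp
    · simp only [Nat.add_sub_cancel]; push_cast; ring

/-- The `sl₂` Verma module of lowest weight `μ`. -/
abbrev VermaMinus (μ : ℂ) : Type := (vermaMinusRep μ).Mod

/-! ## Relaxed modules over the affine algebra -/

/-- The universal enveloping algebra of the affine algebra. -/
abbrev UAffine : Type := UniversalEnvelopingAlgebra ℂ AffineSl2

/-- The inclusion of the affine algebra in its universal enveloping algebra. -/
abbrev toU (a : AffineSl2) : UAffine := UniversalEnvelopingAlgebra.ι ℂ a

attribute [local instance 100] LieRing.ofAssociativeRing in
theorem toU_lie (a b : AffineSl2) : toU ⁅a, b⁆ = toU a * toU b - toU b * toU a :=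
  LieHom.map_lie (UniversalEnvelopingAlgebra.ι ℂ) a b

section Induction

variable (k Δ : ℂ) (M : Type) [AddCommGroup M] [Module ℂ M] [LieRingModule Sl2 M]

open AffineSl2

/-- An `sl₂`-module `M` becomes a module over the subalgebra spanned by `K`, `L₀` and the modes
`x_n`, `n ≥ 0`: `K` acts as `k`, `L₀` as `Δ`, `x_0` as `x`, and `x_n` as `0` for `n > 0`. These are
the relations that move that subalgebra across the tensor sign in `U ⊗ M`, where `U` is the
enveloping algebra of the affine algebra. -/
inductive InductionRel : UAffine ⊗[ℂ] M → Prop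
  | zero_mode (x : Sl2) (m : M) : InductionRel (toU (mode 0 x) ⊗ₜ m - 1 ⊗ₜ ⁅x, m⁆)
  | pos_mode (n : ℤ) (hn : 0 < n) (x : Sl2) (m : M) : InductionRel (toU (mode n x) ⊗ₜ m)
  | central (m : M) : InductionRel (toU K ⊗ₜ m - 1 ⊗ₜ (k • m))
  | conformal (m : M) : InductionRel (toU L0 ⊗ₜ m - 1 ⊗ₜ (Δ • m))

/-- The relaxed Verma module of level `k` induced from the `sl₂`-module `M` placed in conformal
weight `Δ`: the tensor product of the enveloping algebra of the affine algebra with `M` over the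
enveloping algebra of the subalgebra spanned by `K`, `L₀` and the modes `x_n`, `n ≥ 0`. -/
def RelaxedVerma : Type :=
  (UAffine ⊗[ℂ] M) ⧸ Submodule.span UAffine {t | InductionRel k Δ M t}

namespace RelaxedVerma

instance : AddCommGroup (RelaxedVerma k Δ M) :=
  inferInstanceAs (AddCommGroup
    ((UAffine ⊗[ℂ] M) ⧸ Submodule.span UAffine {t | InductionRel k Δ M t}))

instance : Module UAffine (RelaxedVerma k Δ M) :=
  inferInstanceAs (Module UAffine
    ((UAffine ⊗[ℂ] M) ⧸ Submodule.span UAffine {t | InductionRel k Δ M t}))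

instance : Module ℂ (RelaxedVerma k Δ M) :=
  inferInstanceAs (Module ℂ
    ((UAffine ⊗[ℂ] M) ⧸ Submodule.span UAffine {t | InductionRel k Δ M t}))

instance : IsScalarTower ℂ UAffine (RelaxedVerma k Δ M) :=
  inferInstanceAs (IsScalarTower ℂ UAffine
    ((UAffine ⊗[ℂ] M) ⧸ Submodule.span UAffine {t | InductionRel k Δ M t}))

instance : LieRingModule AffineSl2 (RelaxedVerma k Δ M) where
  bracket a w := toU a • w
  add_lie a b w := by rw [toU, map_add, add_smul]
  lie_add a v w := smul_add _ v w
  leibniz_lie a b w := by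
    rw [toU_lie, sub_smul, mul_smul, mul_smul, sub_add_cancel]

instance : LieModule ℂ AffineSl2 (RelaxedVerma k Δ M) where
  smul_lie c a w := by
    change toU (c • a) • w = c • toU a • w
    rw [toU, map_smul, smul_assoc]
  lie_smul c a w := by
    change toU a • c • w = c • toU a • w
    exact smul_algebra_smul_comm c (toU a) w

/-- The vector `m`, viewed in the relaxed Verma module as `1 ⊗ m`. -/
def ofBase : M →ₗ[ℂ] RelaxedVerma k Δ M :=
  ((Submodule.span UAffine {t | InductionRel k Δ M t}).mkQ.restrictScalars ℂ) ∘ₗ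
    TensorProduct.mk ℂ UAffine M 1

theorem lie_def (a : AffineSl2) (w : RelaxedVerma k Δ M) : ⁅a, w⁆ = toU a • w := rfl

variable {k Δ M}

theorem mk_eq_zero {t : UAffine ⊗[ℂ] M} (h : InductionRel k Δ M t) :
    (Submodule.span UAffine {t | InductionRel k Δ M t}).mkQ t = 0 := by
  rw [Submodule.mkQ_apply, Submodule.Quotient.mk_eq_zero]
  exact Submodule.subset_span h

theorem lie_ofBase (a : AffineSl2) (m : M) : ⁅a, ofBase k Δ M m⁆ =
    (Submodule.span UAffine {t | InductionRel k Δ M t}).mkQ (toU a ⊗ₜ m) := by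
  rw [lie_def]
  change toU a • (Submodule.span UAffine {t | InductionRel k Δ M t}).mkQ (1 ⊗ₜ m) = _
  rw [← map_smul, TensorProduct.smul_tmul', smul_eq_mul, mul_one]

theorem mode_zero_lie_ofBase (x : Sl2) (m : M) :
    ⁅mode 0 x, ofBase k Δ M m⁆ = ofBase k Δ M ⁅x, m⁆ := by
  rw [lie_ofBase]
  exact sub_eq_zero.mp ((map_sub _ _ _).symm.trans (mk_eq_zero (.zero_mode x m)))

theorem mode_pos_lie_ofBase {n : ℤ} (hn : 0 < n) (x : Sl2) (m : M) :
    ⁅mode n x, ofBase k Δ M m⁆ = 0 := by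
  rw [lie_ofBase]
  exact mk_eq_zero (.pos_mode n hn x m)

theorem K_lie_ofBase (m : M) : ⁅K, ofBase k Δ M m⁆ = k • ofBase k Δ M m := by
  rw [lie_ofBase, ← map_smul]
  exact sub_eq_zero.mp ((map_sub _ _ _).symm.trans (mk_eq_zero (.central m)))

theorem L0_lie_ofBase (m : M) : ⁅L0, ofBase k Δ M m⁆ = Δ • ofBase k Δ M m := by
  rw [lie_ofBase, ← map_smul]
  exact sub_eq_zero.mp ((map_sub _ _ _).symm.trans (mk_eq_zero (.conformal m)))

end RelaxedVerma

end Induction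

section Quotients

variable (N : Type) [AddCommGroup N] [Module ℂ N] [LieRingModule AffineSl2 N]
  [LieModule ℂ AffineSl2 N]

/-- The action of `L₀` on an affine module. -/
def actL0 : Module.End ℂ N := LieModule.toEnd ℂ AffineSl2 N AffineSl2.L0

/-- The space of ground states of an affine module: it is spanned by the generalised eigenvectors
of `L₀` whose eigenvalue has minimal real part among the eigenvalues of `L₀`. -/
def groundStates : Submodule ℂ N :=
  ⨆ Δ ∈ {Δ : ℂ | ∀ Δ' : ℂ, (actL0 N).HasEigenvalue Δ' → Δ.re ≤ Δ'.re},
    (actL0 N).maxGenEigenspace Δ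

/-- The sum of the submodules that have zero intersection with the space of ground states. -/
def groundRadical : LieSubmodule ℂ AffineSl2 N :=
  sSup {I : LieSubmodule ℂ AffineSl2 N | I.toSubmodule ⊓ groundStates N = ⊥}

/-- The sum of the proper submodules; for a module which has a unique maximal proper submodule,
such as a highest-weight module, it is that submodule. -/
def maxProper : LieSubmodule ℂ AffineSl2 N :=
  sSup {I : LieSubmodule ℂ AffineSl2 N | I ≠ ⊤}

end Quotients

/-- The affine module `E_{lam; q}` of level `k` with ground states of conformal weight `Δ`: the
quotient of the relaxed Verma module induced from the dense module by the sum of its submodules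
that have zero intersection with the space of ground states. -/
abbrev RelaxedE (k Δ lam q : ℂ) : Type :=
  RelaxedVerma k Δ (Dense lam q) ⧸ groundRadical (RelaxedVerma k Δ (Dense lam q))

/-- The simple highest-weight module `L⁺_μ` of level `k` whose highest-weight vector has
`sl₂`-weight `μ` and conformal weight `Δ`: the simple quotient of the affine Verma module. -/
abbrev LPlus (k Δ μ : ℂ) : Type :=
  RelaxedVerma k Δ (VermaPlus μ) ⧸ maxProper (RelaxedVerma k Δ (VermaPlus μ))

/-- The simple module `L⁻_μ` of level `k`, highest-weight for the Weyl-reflected Borel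
subalgebra, whose generating vector has `sl₂`-weight `μ` and conformal weight `Δ`: the simple
quotient of the relaxed Verma module induced from the `sl₂` Verma module of lowest weight `μ`. -/
abbrev LMinus (k Δ μ : ℂ) : Type :=
  RelaxedVerma k Δ (VermaMinus μ) ⧸ maxProper (RelaxedVerma k Δ (VermaMinus μ))

/-! ## Admissible levels -/

/-- The level `k` with `k + 2 = u / v`. -/
def level (u v : ℕ) : ℂ := u / v - 2

/-- The weight `μ_{r,s} = (r - 1 - (u / v) s) ω`. -/
def muRS (u v : ℕ) (r s : ℤ) : ℂ := r - 1 - (u : ℂ) / v * s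

/-- The Casimir eigenvalue `q_{r,s} = ((v r - u s)² - v²) / (2 v²)`. -/
def qRS (u v : ℕ) (r s : ℤ) : ℂ := (((v : ℂ) * r - u * s) ^ 2 - (v : ℂ) ^ 2) / (2 * (v : ℂ) ^ 2)

/-- The conformal weight `Δ_q = q / (2 (k + 2))` given by the Sugawara construction. -/
def sugawara (k q : ℂ) : ℂ := q / (2 * (k + 2))

end RelaxedSl2

set_option linter.unusedSectionVars false

namespace RelaxedSl2

/-! ## The universal property of relaxed Verma modules -/

open AffineSl2

section Universal

variable {N : Type} [AddCommGroup N] [Module ℂ N] [LieRingModule AffineSl2 N]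
  [LieModule ℂ AffineSl2 N]

/-! For a nonintegral weight `μ` and `q = (μ, μ + 2ρ)`, the dense `sl₂`-module is an extension of
the lowest-weight Verma module of weight `μ + α` by the highest-weight Verma module of weight `μ`,
and both of these are simple. Inducing and dividing out the largest submodule that avoids the ground
states is functorial in the module of ground states and preserves injections and surjections
(`exists_quotMap`, `injective_of_base`, `surjective_of_base`). This yields an injection `ι` and a
surjection `π` with `π ∘ ι = 0`. Exactness in the middle does not follow formally, and it is the
heart of the proof.

It comes from a comparison of weight multiplicities. Let `E'` be the affine module built on
`linkedRep μ`, the extension of the same two Verma modules in the opposite order. As `ad e₀` and `ad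
f₀` are nilpotent, the vectors that powers of `e₀` or `f₀` carry into a given submodule form a
submodule again (`saturation`). So properties of `e` and `f` spread from the ground states: `f` is
injective on `E` and its powers push every vector into `L⁺`, while `e` is injective on `E'` and its
powers push every vector into `L⁻`. In a fixed conformal weight, where weight spaces are
finite-dimensional, this gives `dim E_J ≤ dim L⁺_{J-N} ≤ dim E'_{J-N} ≤ dim L⁻_j` for large `j`.
Also `dim E_j` decreases in `j`, so `π` is injective on weight spaces of large weight
(`exists_finrank_le`, `eq_zero_of_finrank_le`).

A weight vector of smaller weight in the kernel of `π` is raised by `e` into that range. Modulo `L⁺`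
no nonzero weight vector is annihilated by `e`, because `f` is locally nilpotent there and the
weights are nonintegral (`mem_range_of_lie_mem`). Descending induction puts the kernel inside the
image of `ι` (`ker_le_range`).

A splitting would send the lowest-weight vector of `L⁻` to a nonzero vector of `E` annihilated by
`f`, which is impossible.

Two foundations support this: the embedding of the ground states in the relaxed Verma module
(`RelaxedVerma.ofBase_injective`), obtained from an explicit action on `U(n) ⊗ M`, and the grading
by conformal weight and `sl₂`-weight. The arithmetic of `u`, `v`, `s` enters through
`muRS_ne_intCast`. -/

theorem AffineSl2.mode_add (n : ℤ) (x y : Sl2) : mode n (x + y) = mode n x + mode n y := by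
  ext1 <;> simp [mode]

theorem AffineSl2.mode_smul (n : ℤ) (c : ℂ) (x : Sl2) : mode n (c • x) = c • mode n x := by
  ext1 <;> simp [mode]

/-- A subspace that contains all `x_n w`, `K w` and `L₀ w` contains `a w` for all `a`. -/
theorem lie_mem_of_modes {S : Submodule ℂ N} {w : N} (hm : ∀ n x, ⁅mode n x, w⁆ ∈ S)
    (hK : ⁅K, w⁆ ∈ S) (hL : ⁅L0, w⁆ ∈ S) (a : AffineSl2) : ⁅a, w⁆ ∈ S := by
  have key : ∀ l : Loop, ⁅(⟨l, 0, 0⟩ : AffineSl2), w⁆ ∈ S := by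
    intro l
    induction l using Finsupp.induction_linear with
    | zero =>
      have : (⟨0, 0, 0⟩ : AffineSl2) = 0 := rfl
      rw [this, zero_lie]; exact S.zero_mem
    | add l l' h h' =>
      have : (⟨l + l', 0, 0⟩ : AffineSl2) = ⟨l, 0, 0⟩ + ⟨l', 0, 0⟩ := by ext1 <;> simp
      rw [this, add_lie]; exact S.add_mem h h'
    | single n x => exact hm n x
  have h : a = ⟨a.loop, 0, 0⟩ + a.cK • K + a.cL • L0 := by ext1 <;> simp [K, L0]
  rw [h, add_lie, add_lie, smul_lie, smul_lie]
  exact S.add_mem (S.add_mem (key _) (S.smul_mem _ hK)) (S.smul_mem _ hL)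

variable (k Δ : ℂ) {M : Type} [AddCommGroup M] [Module ℂ M] [LieRingModule Sl2 M]

/-- The map `φ` sends the `sl₂`-module `M` to vectors of level `k` and conformal weight `Δ` that
are annihilated by the positive modes, compatibly with the action of the zero modes. -/
structure IsGroundMap (φ : M →ₗ[ℂ] N) : Prop where
  zero_mode : ∀ x m, ⁅mode 0 x, φ m⁆ = φ ⁅x, m⁆
  pos_mode : ∀ {n : ℤ}, 0 < n → ∀ x m, ⁅mode n x, φ m⁆ = 0
  central : ∀ m, ⁅K, φ m⁆ = k • φ m
  conformal : ∀ m, ⁅L0, φ m⁆ = Δ • φ m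

/-- No proper submodule contains the image of `φ`. -/
def Generates (φ : M →ₗ[ℂ] N) : Prop :=
  ∀ S : LieSubmodule ℂ AffineSl2 N, (∀ m, φ m ∈ S) → S = ⊤

variable {k Δ}

theorem IsGroundMap.comp {N' : Type} [AddCommGroup N'] [Module ℂ N'] [LieRingModule AffineSl2 N']
    [LieModule ℂ AffineSl2 N'] {φ : M →ₗ[ℂ] N} (h : IsGroundMap k Δ φ)
    (g : N →ₗ⁅ℂ, AffineSl2⁆ N') : IsGroundMap k Δ ((g : N →ₗ[ℂ] N') ∘ₗ φ) where
  zero_mode x m := by simp [← LieModuleHom.map_lie, h.zero_mode]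
  pos_mode hn x m := by simp [← LieModuleHom.map_lie, h.pos_mode hn]
  central m := by simp [← LieModuleHom.map_lie, h.central]
  conformal m := by simp [← LieModuleHom.map_lie, h.conformal]

theorem Generates.comp {N' : Type} [AddCommGroup N'] [Module ℂ N'] [LieRingModule AffineSl2 N']
    [LieModule ℂ AffineSl2 N'] {φ : M →ₗ[ℂ] N} (h : Generates φ)
    {g : N →ₗ⁅ℂ, AffineSl2⁆ N'} (hg : Function.Surjective g) :
    Generates ((g : N →ₗ[ℂ] N') ∘ₗ φ) := by
  intro S hS
  have h1 := h (S.comap g) fun m => by simpa using hS m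
  rw [eq_top_iff]
  intro y _
  obtain ⟨x, rfl⟩ := hg y
  have : x ∈ S.comap g := h1 ▸ LieSubmodule.mem_top x
  simpa using this

theorem Generates.hom_ext {N' : Type} [AddCommGroup N'] [Module ℂ N'] [LieRingModule AffineSl2 N']
    [LieModule ℂ AffineSl2 N'] {φ : M →ₗ[ℂ] N} (h : Generates φ)
    {g g' : N →ₗ⁅ℂ, AffineSl2⁆ N'} (hg : ∀ m, g (φ m) = g' (φ m)) (w : N) : g w = g' w := by
  have h1 := h (g - g').ker fun m => by simp [LieModuleHom.mem_ker, hg]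
  have : w ∈ (g - g').ker := h1 ▸ LieSubmodule.mem_top w
  rwa [LieModuleHom.mem_ker, LieModuleHom.sub_apply, sub_eq_zero] at this

variable (N) in
/-- The action of the enveloping algebra on an affine module. -/
def envAct : UAffine →ₐ[ℂ] Module.End ℂ N :=
  UniversalEnvelopingAlgebra.lift ℂ (LieModule.toEnd ℂ AffineSl2 N)

theorem envAct_toU (a : AffineSl2) (w : N) : envAct N (toU a) w = ⁅a, w⁆ := by
  rw [envAct, toU, UniversalEnvelopingAlgebra.lift_ι_apply]; rfl

/-- The map `U ⊗ M → N`, `a ⊗ m ↦ a φ(m)`. -/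
def envTensor (φ : M →ₗ[ℂ] N) : UAffine ⊗[ℂ] M →ₗ[ℂ] N :=
  TensorProduct.lift (LinearMap.lcomp ℂ N φ ∘ₗ (envAct N).toLinearMap)

theorem envTensor_tmul (φ : M →ₗ[ℂ] N) (a : UAffine) (m : M) :
    envTensor φ (a ⊗ₜ m) = envAct N a (φ m) := rfl

theorem envTensor_smul (φ : M →ₗ[ℂ] N) (a : UAffine) (t : UAffine ⊗[ℂ] M) :
    envTensor φ (a • t) = envAct N a (envTensor φ t) := by
  induction t with
  | zero => simp
  | add t t' h h' => rw [smul_add, map_add, h, h', map_add, map_add]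
  | tmul b m =>
    rw [TensorProduct.smul_tmul', envTensor_tmul, envTensor_tmul, smul_eq_mul, map_mul]; rfl

/-- The four kinds of induction relation match the four conditions on a ground map, so the map on `U
⊗ M` descends to the relaxed Verma module. -/
theorem envTensor_eq_zero {φ : M →ₗ[ℂ] N} (h : IsGroundMap k Δ φ) {t : UAffine ⊗[ℂ] M}
    (ht : t ∈ Submodule.span UAffine {t | InductionRel k Δ M t}) : envTensor φ t = 0 := by
  induction ht using Submodule.span_induction with
  | zero => simp
  | add t t' _ _ h h' => rw [map_add, h, h', add_zero]
  | smul a t _ h' => rw [envTensor_smul, h', map_zero]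
  | mem t ht =>
    rcases ht with ⟨x, m⟩ | ⟨n, hn, x, m⟩ | m | m
    · simp only [map_sub, envTensor_tmul, envAct_toU, map_one, Module.End.one_apply, h.zero_mode,
        sub_self]
    · rw [envTensor_tmul, envAct_toU, h.pos_mode hn]
    · simp only [map_sub, envTensor_tmul, envAct_toU, map_one, Module.End.one_apply, h.central,
        map_smul, sub_self]
    · simp only [map_sub, envTensor_tmul, envAct_toU, map_one, Module.End.one_apply, h.conformal,
        map_smul, sub_self]

namespace RelaxedVerma

theorem isGroundMap_ofBase : IsGroundMap k Δ (ofBase k Δ M) where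
  zero_mode := mode_zero_lie_ofBase
  pos_mode hn := mode_pos_lie_ofBase hn
  central := K_lie_ofBase
  conformal := L0_lie_ofBase

/-- The affine module map out of a relaxed Verma module that extends a ground map. -/
def lift {φ : M →ₗ[ℂ] N} (h : IsGroundMap k Δ φ) : RelaxedVerma k Δ M →ₗ⁅ℂ, AffineSl2⁆ N where
  toLinearMap :=
    (Submodule.liftQ ((Submodule.span UAffine {t | InductionRel k Δ M t}).restrictScalars ℂ)
      (envTensor φ) fun _ ht => envTensor_eq_zero h ht) ∘ₗ
      (Submodule.Quotient.restrictScalarsEquiv ℂ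
        (Submodule.span UAffine {t | InductionRel k Δ M t})).symm.toLinearMap
  map_lie' {a w} := by
    obtain ⟨t, rfl⟩ := Submodule.mkQ_surjective _ w
    exact (envTensor_smul φ (toU a) t).trans (envAct_toU a _)

theorem lift_ofBase {φ : M →ₗ[ℂ] N} (h : IsGroundMap k Δ φ) (m : M) :
    lift h (ofBase k Δ M m) = φ m := by
  change envTensor φ (1 ⊗ₜ m) = φ m
  rw [envTensor_tmul, map_one]; rfl

end RelaxedVerma

/-! ### Generation of the enveloping algebra by the Lie algebra -/

section

attribute [local instance 100] LieRing.ofAssociativeRing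

/-- A subalgebra of the enveloping algebra that contains the Lie algebra is everything. -/
theorem mem_of_forall_ι_mem {L : Type} [LieRing L] [LieAlgebra ℂ L]
    (B : Subalgebra ℂ (UniversalEnvelopingAlgebra ℂ L))
    (h : ∀ a, UniversalEnvelopingAlgebra.ι ℂ a ∈ B) (b : UniversalEnvelopingAlgebra ℂ L) :
    b ∈ B := by
  let f : L →ₗ⁅ℂ⁆ B :=
    { toLinearMap := LinearMap.codRestrict (Subalgebra.toSubmodule B)
        (UniversalEnvelopingAlgebra.ι ℂ : L →ₗ⁅ℂ⁆ _).toLinearMap h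
      map_lie' := fun {x y} => Subtype.ext
        (LieHom.map_lie (UniversalEnvelopingAlgebra.ι ℂ) x y) }
  -- Lifting the Lie algebra into `B` and including `B` back agrees with the identity on generators,
  -- hence everywhere.
  have h1 : B.val.comp (UniversalEnvelopingAlgebra.lift ℂ f) = AlgHom.id ℂ _ := by
    apply UniversalEnvelopingAlgebra.hom_ext
    ext x
    change ((UniversalEnvelopingAlgebra.lift ℂ f (UniversalEnvelopingAlgebra.ι ℂ x) : B) :
      UniversalEnvelopingAlgebra ℂ L) = UniversalEnvelopingAlgebra.ι ℂ x
    rw [UniversalEnvelopingAlgebra.lift_ι_apply]; rfl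
  have h2 := DFunLike.congr_fun h1 b
  rw [AlgHom.id_apply] at h2
  rw [← h2]
  exact (UniversalEnvelopingAlgebra.lift ℂ f b).2

/-- Induction on the enveloping algebra by left multiplication with elements of the Lie algebra. -/
theorem env_induction {L : Type} [LieRing L] [LieAlgebra ℂ L]
    (S : Submodule ℂ (UniversalEnvelopingAlgebra ℂ L)) (h1 : 1 ∈ S)
    (h : ∀ a b, b ∈ S → UniversalEnvelopingAlgebra.ι ℂ a * b ∈ S)
    (b : UniversalEnvelopingAlgebra ℂ L) : b ∈ S := by
  -- The multipliers of `S` form a subalgebra, and it contains the Lie algebra; applying a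
  -- multiplier to `1` gives the claim.
  let B : Subalgebra ℂ (UniversalEnvelopingAlgebra ℂ L) :=
    { carrier := {c | ∀ b ∈ S, c * b ∈ S}
      mul_mem' := fun {c d} hc hd b hb => by rw [mul_assoc]; exact hc _ (hd _ hb)
      add_mem' := fun {c d} hc hd b hb => by rw [add_mul]; exact S.add_mem (hc _ hb) (hd _ hb)
      algebraMap_mem' := fun t b hb => by
        rw [← Algebra.smul_def]; exact S.smul_mem _ hb }
  have h2 := mem_of_forall_ι_mem B (fun a => h a) b 1 h1
  rwa [mul_one] at h2

end

/-- A Lie submodule is stable under the whole enveloping algebra, and the class of `a ⊗ m` is `a`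
times the class of `1 ⊗ m`. -/
theorem RelaxedVerma.generates_ofBase : Generates (ofBase k Δ M) := by
  intro S hS
  rw [eq_top_iff]
  intro w _
  have key : ∀ (a : UAffine) (w : RelaxedVerma k Δ M), w ∈ S → a • w ∈ S := by
    intro a w hw
    let B : Submodule ℂ UAffine :=
      { carrier := {c | c • w ∈ S}
        zero_mem' := by change (0 : UAffine) • w ∈ S; rw [zero_smul]; exact S.zero_mem
        add_mem' := fun {c d} hc hd => by
          change (c + d) • w ∈ S
          rw [add_smul]; exact S.add_mem hc hd
        smul_mem' := fun t c hc => by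
          change (t • c) • w ∈ S
          rw [smul_assoc]; exact S.smul_mem _ hc }
    refine env_induction B ?_ ?_ a
    · change (1 : UAffine) • w ∈ S
      rwa [one_smul]
    · intro a c hc
      change (toU a * c) • w ∈ S
      rw [mul_smul]
      exact S.lie_mem hc
  obtain ⟨t, rfl⟩ := Submodule.mkQ_surjective
    (Submodule.span UAffine {t | InductionRel k Δ M t}) w
  induction t with
  | zero => rw [map_zero]; exact S.zero_mem
  | add t t' h h' => rw [map_add]; exact S.add_mem (h trivial) (h' trivial)
  | tmul a m =>
    have := key a _ (hS m)
    have e : a • ofBase k Δ M m = (Submodule.span UAffine {t | InductionRel k Δ M t}).mkQ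
        (a ⊗ₜ m) := by
      change a • (Submodule.span UAffine {t | InductionRel k Δ M t}).mkQ (1 ⊗ₜ m) = _
      rw [← map_smul, TensorProduct.smul_tmul', smul_eq_mul, mul_one]
    rwa [← e]

end Universal

/-! ## Induced modules on `U(n) ⊗ M` -/

section Induced

set_option maxSynthPendingDepth 5

attribute [local instance 100] LieRing.ofAssociativeRing

variable {L : Type} [LieRing L] [LieAlgebra ℂ L] (n : LieSubalgebra ℂ L)
  (M : Type) [AddCommGroup M] [Module ℂ M]

/-- The underlying space `U(n) ⊗ M` of the induced module. -/
abbrev IndSpace : Type := UniversalEnvelopingAlgebra ℂ n ⊗[ℂ] M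

/-- Left multiplication by elements of `U(n)`. -/
def indMul : UniversalEnvelopingAlgebra ℂ n →ₐ[ℂ] Module.End ℂ (IndSpace n M) :=
  Algebra.lsmul ℂ ℂ (IndSpace n M)

/-- Left multiplication by elements of `n`. -/
def indLeft : n →ₗ[ℂ] Module.End ℂ (IndSpace n M) :=
  (indMul n M).toLinearMap ∘ₗ (UniversalEnvelopingAlgebra.ι ℂ : n →ₗ⁅ℂ⁆ _).toLinearMap

theorem indLeft_tmul (y : n) (b : UniversalEnvelopingAlgebra ℂ n) (m : M) :
    indLeft n M y (b ⊗ₜ m) = (UniversalEnvelopingAlgebra.ι ℂ y * b) ⊗ₜ m := rfl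

theorem indLeft_lie (y z : n) (w : IndSpace n M) :
    indLeft n M ⁅y, z⁆ w = indLeft n M y (indLeft n M z w) - indLeft n M z (indLeft n M y w) := by
  have h : UniversalEnvelopingAlgebra.ι ℂ ⁅y, z⁆ =
      UniversalEnvelopingAlgebra.ι ℂ y * UniversalEnvelopingAlgebra.ι ℂ z -
        UniversalEnvelopingAlgebra.ι ℂ z * UniversalEnvelopingAlgebra.ι ℂ y :=
    LieHom.map_lie (UniversalEnvelopingAlgebra.ι ℂ) y z
  change indMul n M (UniversalEnvelopingAlgebra.ι ℂ ⁅y, z⁆) w = _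
  rw [h, map_sub, map_mul, map_mul]; rfl

/-- The operator `Φ ↦ (x ↦ y Φ(x) - Φ([y, x]))` on `Hom(L, Hom(M, U(n) ⊗ M))`. -/
def indHomOp : n →ₗ[ℂ] Module.End ℂ (L →ₗ[ℂ] M →ₗ[ℂ] IndSpace n M) :=
  LinearMap.mk₂ ℂ (fun y Φ => (LinearMap.llcomp ℂ M _ _ (indLeft n M y)) ∘ₗ Φ -
      Φ ∘ₗ (LieModule.toEnd ℂ L L (y : L)))
    (fun y z Φ => by ext; simp; abel)
    (fun c y Φ => by ext; simp [smul_sub])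
    (fun y Φ Ψ => by ext; simp; abel)
    (fun c y Φ => by ext; simp [smul_sub])

theorem indHomOp_apply (y : n) (Φ : L →ₗ[ℂ] M →ₗ[ℂ] IndSpace n M) (x : L) (m : M) :
    indHomOp n M y Φ x m = indLeft n M y (Φ x m) - Φ ⁅(y : L), x⁆ m := rfl

/-- The action of `n` on `Hom(L, Hom(M, U(n) ⊗ M))`. -/
def indHom : n →ₗ⁅ℂ⁆ Module.End ℂ (L →ₗ[ℂ] M →ₗ[ℂ] IndSpace n M) where
  toLinearMap := indHomOp n M
  map_lie' {y z} := by
    ext Φ x m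
    change indHomOp n M ⁅y, z⁆ Φ x m = (indHomOp n M y (indHomOp n M z Φ)) x m -
      (indHomOp n M z (indHomOp n M y Φ)) x m
    simp only [indHomOp_apply, indLeft_lie, map_sub, LieSubalgebra.coe_bracket, lie_lie,
      LinearMap.sub_apply]
    abel

variable {n M} (p : L →ₗ[ℂ] n) (τ : L →ₗ[ℂ] Module.End ℂ M)

/-- The value at `1 ∈ U(n)` of the action: `x ↦ (m ↦ p(x) ⊗ m + 1 ⊗ τ(x) m)`. -/
def indInit : L →ₗ[ℂ] M →ₗ[ℂ] IndSpace n M :=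
  TensorProduct.mk ℂ _ M ∘ₗ (UniversalEnvelopingAlgebra.ι ℂ : n →ₗ⁅ℂ⁆ _).toLinearMap ∘ₗ p +
    LinearMap.llcomp ℂ M _ _ (TensorProduct.mk ℂ (UniversalEnvelopingAlgebra ℂ n) M 1) ∘ₗ τ

/-- The linear map by which `L` acts on `U(n) ⊗ M`. -/
def indAct : L →ₗ[ℂ] Module.End ℂ (IndSpace n M) :=
  TensorProduct.uncurry (RingHom.id ℂ) _ M _ ∘ₗ
    LinearMap.flip ((LinearMap.applyₗ (indInit p τ)) ∘ₗ
      (UniversalEnvelopingAlgebra.lift ℂ (indHom n M)).toLinearMap)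

theorem indAct_tmul (x : L) (a : UniversalEnvelopingAlgebra ℂ n) (m : M) :
    indAct p τ x (a ⊗ₜ m) = UniversalEnvelopingAlgebra.lift ℂ (indHom n M) a (indInit p τ) x m :=
  rfl

theorem indAct_one_tmul (x : L) (m : M) :
    indAct p τ x (1 ⊗ₜ m) = UniversalEnvelopingAlgebra.ι ℂ (p x) ⊗ₜ m + 1 ⊗ₜ τ x m := by
  rw [indAct_tmul, map_one]; rfl

/-- This recursion in `U(n)` is what the operators `indHom` encode: lifting them to the enveloping
algebra makes the recursion consistent without a choice of basis. -/
theorem indAct_indLeft (x : L) (y : n) (w : IndSpace n M) :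
    indAct p τ x (indLeft n M y w) = indLeft n M y (indAct p τ x w) - indAct p τ ⁅(y : L), x⁆ w := by
  induction w using TensorProduct.induction_on with
  | zero => simp
  | add w w' h h' => simp only [map_add, h, h']; abel
  | tmul a m =>
    rw [indLeft_tmul, indAct_tmul, map_mul, UniversalEnvelopingAlgebra.lift_ι_apply]
    exact indHomOp_apply n M y _ x m

/-- Induction on `U(n) ⊗ M` by left multiplication with elements of `n`. -/
theorem ind_induction (S : Submodule ℂ (IndSpace n M)) (h1 : ∀ m, 1 ⊗ₜ m ∈ S)
    (h : ∀ y w, w ∈ S → indLeft n M y w ∈ S) (w : IndSpace n M) : w ∈ S := by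
  induction w using TensorProduct.induction_on with
  | zero => exact S.zero_mem
  | add w w' h h' => exact S.add_mem h h'
  | tmul a m =>
    exact env_induction (S.comap ((TensorProduct.mk ℂ (UniversalEnvelopingAlgebra ℂ n) M).flip m))
      (h1 m) (fun y b hb => h y _ hb) a

variable (hp : ∀ y : n, p y = y) (hτ : ∀ y : n, τ y = 0)
  (hker : ∀ x y, p x = 0 → p y = 0 → p ⁅x, y⁆ = 0 ∧ τ ⁅x, y⁆ = τ x * τ y - τ y * τ x)

-- Both sides agree on `1 ⊗ m` and obey the same recursion; the inductive step uses that `⁅y, z⁆`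
-- lies in `n` again.
include hp hτ in
theorem indAct_coe (y : n) (w : IndSpace n M) : indAct p τ y w = indLeft n M y w := by
  revert y
  suffices h : w ∈ (⨅ y : n, LinearMap.ker (indAct p τ y - indLeft n M y)) by
    intro y
    have := (Submodule.mem_iInf _).mp h y
    rwa [LinearMap.mem_ker, LinearMap.sub_apply, sub_eq_zero] at this
  refine ind_induction _ (fun m => ?_) (fun z w hw => ?_) w
  · refine (Submodule.mem_iInf _).mpr fun y => ?_
    rw [LinearMap.mem_ker, LinearMap.sub_apply, sub_eq_zero, indAct_one_tmul, hp, hτ,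
      indLeft_tmul, mul_one]
    simp
  · refine (Submodule.mem_iInf _).mpr fun y => ?_
    have h (y : n) : indAct p τ y w = indLeft n M y w := by
      have := (Submodule.mem_iInf _).mp hw y
      rwa [LinearMap.mem_ker, LinearMap.sub_apply, sub_eq_zero] at this
    rw [LinearMap.mem_ker, LinearMap.sub_apply, sub_eq_zero, indAct_indLeft, h,
      ← LieSubalgebra.coe_bracket, h, indLeft_lie]
    abel

-- The defect `C x y` of the bracket relation vanishes when one argument lies in `n`, since this is
-- the recursion itself. On `1 ⊗ m` only arguments in the kernel of `p` remain, where `hker` says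
-- that `τ` is a representation. The Jacobi identity carries the vanishing through left
-- multiplication by `n`.
include hp hτ hker in
theorem indAct_lie (x y : L) (w : IndSpace n M) : indAct p τ ⁅x, y⁆ w =
    indAct p τ x (indAct p τ y w) - indAct p τ y (indAct p τ x w) := by
  have hc := indAct_coe p τ hp hτ
  let C (x y : L) : Module.End ℂ (IndSpace n M) :=
    indAct p τ ⁅x, y⁆ - (indAct p τ x * indAct p τ y - indAct p τ y * indAct p τ x)
  have hC (x y : L) (w) : C x y w = indAct p τ ⁅x, y⁆ w -
    (indAct p τ x (indAct p τ y w) - indAct p τ y (indAct p τ x w)) := rfl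
  suffices h : w ∈ (⨅ x : L, ⨅ y : L, LinearMap.ker (C x y)) by
    simp only [Submodule.mem_iInf, LinearMap.mem_ker, hC, sub_eq_zero] at h
    exact h x y
  have hleft : ∀ (x : L) (y : n) (w), C x y w = 0 := by
    intro x y w
    rw [hC, hc, hc, indAct_indLeft, ← lie_skew, map_neg, LinearMap.neg_apply]; abel
  have hskew : ∀ (x y : L) (w), C x y w = -C y x w := by
    intro x y w
    rw [hC, hC, ← lie_skew, map_neg, LinearMap.neg_apply]; abel
  have hadd : ∀ (x y y' : L) (w), C x (y + y') w = C x y w + C x y' w := by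
    intro x y y' w
    simp only [hC, lie_add, map_add, LinearMap.add_apply]; abel
  have hsplit (x : L) : ∃ (y : n) (z : L), p z = 0 ∧ x = y + z :=
    ⟨p x, x - p x, by rw [map_sub, hp, sub_self], by abel⟩
  refine ind_induction _ (fun m => ?_) (fun z w hw => ?_) w
  · simp only [Submodule.mem_iInf, LinearMap.mem_ker]
    intro x y
    obtain ⟨x1, x2, hx2, rfl⟩ := hsplit x
    obtain ⟨y1, y2, hy2, rfl⟩ := hsplit y
    rw [hadd, hleft, zero_add, hskew, hadd, hleft, zero_add, hskew, neg_neg, hC]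
    obtain ⟨h1, h2⟩ := hker x2 y2 hx2 hy2
    simp only [indAct_one_tmul, h1, h2, hx2, hy2, map_zero, TensorProduct.zero_tmul, zero_add,
      LinearMap.sub_apply, Module.End.mul_apply, TensorProduct.tmul_sub, sub_self]
  · simp only [Submodule.mem_iInf, LinearMap.mem_ker] at hw ⊢
    intro x y
    have h1 := hw ⁅(z : L), x⁆ y
    have h2 := hw x ⁅(z : L), y⁆
    have h3 := hw x y
    rw [hC, sub_eq_zero] at h1 h2 h3
    rw [hC, sub_eq_zero]
    have h4 : indAct p τ ⁅(z : L), ⁅x, y⁆⁆ w = indAct p τ ⁅⁅(z : L), x⁆, y⁆ w +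
        indAct p τ ⁅x, ⁅(z : L), y⁆⁆ w := by
      rw [leibniz_lie (z : L) x y, map_add, LinearMap.add_apply]
    simp only [indAct_indLeft, map_sub, h3, h4, h1, h2]
    abel

/-- The induced representation on `U(n) ⊗ M`. -/
def indRep : L →ₗ⁅ℂ⁆ Module.End ℂ (IndSpace n M) where
  toLinearMap := indAct p τ
  map_lie' {x y} := LinearMap.ext fun w => indAct_lie p τ hp hτ hker x y w

-- The augmentation of `U(n)` recovers `m` from `1 ⊗ m`.
variable (n M) in
theorem one_tmul_injective :
    Function.Injective fun m : M => (1 : UniversalEnvelopingAlgebra ℂ n) ⊗ₜ[ℂ] m := by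
  let ε : UniversalEnvelopingAlgebra ℂ n →ₐ[ℂ] ℂ :=
    UniversalEnvelopingAlgebra.lift ℂ
      (0 : n →ₗ⁅ℂ⁆ ℂ)
  intro m m' h
  have := congrArg ((TensorProduct.lid ℂ M).toLinearMap ∘ₗ LinearMap.rTensor M ε.toLinearMap) h
  simpa using this

end Induced

/-! ### Embedding of the ground states in the relaxed Verma module -/

section Embedding

attribute [local instance 100] LieRing.ofAssociativeRing

theorem supported_le_of_single {s : Set ℤ} {S : Submodule ℂ Loop}
    (h : ∀ n ∈ s, ∀ x, Finsupp.single n x ∈ S) : Finsupp.supported Sl2 ℂ s ≤ S := by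
  intro l hl
  rw [← Finsupp.sum_single l]
  exact S.sum_mem fun n hn => h n ((Finsupp.mem_supported ℂ l).mp hl hn) _

theorem loopBracket_mem_supported {s t u : Set ℤ} (h : ∀ m ∈ s, ∀ n ∈ t, m + n ∈ u) {a b : Loop}
    (ha : a ∈ Finsupp.supported Sl2 ℂ s) (hb : b ∈ Finsupp.supported Sl2 ℂ t) :
    loopBracket a b ∈ Finsupp.supported Sl2 ℂ u := by
  refine supported_le_of_single (S := (Finsupp.supported Sl2 ℂ u).comap (loopBracket.flip b))
    (fun m hm x => ?_) ha
  refine supported_le_of_single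
    (S := (Finsupp.supported Sl2 ℂ u).comap (loopBracket (Finsupp.single m x)))
    (fun n hn y => ?_) hb
  change loopBracket (Finsupp.single m x) (Finsupp.single n y) ∈ Finsupp.supported Sl2 ℂ u
  rw [loopBracket_single]
  exact Finsupp.single_mem_supported ℂ _ (h m hm n hn)

theorem loopCocycle_eq_zero {s t : Set ℤ} (h : ∀ m ∈ s, ∀ n ∈ t, m + n = 0 → m = 0) {a b : Loop}
    (ha : a ∈ Finsupp.supported Sl2 ℂ s) (hb : b ∈ Finsupp.supported Sl2 ℂ t) :
    loopCocycle a b = 0 := by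
  refine supported_le_of_single (S := LinearMap.ker (loopCocycle.flip b)) (fun m hm x => ?_) ha
  refine supported_le_of_single (S := LinearMap.ker (loopCocycle (Finsupp.single m x)))
    (fun n hn y => ?_) hb
  rw [LinearMap.mem_ker, loopCocycle_single]
  split_ifs with h0
  · rw [h m hm n hn h0]; simp
  · rfl

/-- Two nonnegative exponents add up to `0` only if both are `0`, so taking the coefficient of `t⁰`
respects brackets on the nonnegative part. -/
theorem loopBracket_apply_zero {a b : Loop} (ha : a ∈ Finsupp.supported Sl2 ℂ {n : ℤ | 0 ≤ n})
    (hb : b ∈ Finsupp.supported Sl2 ℂ {n : ℤ | 0 ≤ n}) :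
    loopBracket a b 0 = ⁅a 0, b 0⁆ := by
  let ev : Loop →ₗ[ℂ] Sl2 := Finsupp.lapply 0
  let br : Sl2 →ₗ[ℂ] Module.End ℂ Sl2 := LieModule.toEnd ℂ Sl2 Sl2
  refine supported_le_of_single (S := LinearMap.ker (ev ∘ₗ loopBracket.flip b -
    (br.flip (b 0)) ∘ₗ ev)) (fun m hm x => ?_) ha |> fun h => sub_eq_zero.mp h
  refine supported_le_of_single (S := LinearMap.ker (ev ∘ₗ loopBracket (Finsupp.single m x) -
    (br (Finsupp.single m x 0)) ∘ₗ ev)) (fun n hn y => ?_) hb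
  change loopBracket (Finsupp.single m x) (Finsupp.single n y) 0 -
    ⁅Finsupp.single m x 0, Finsupp.single n y 0⁆ = 0
  have hm' : (0 : ℤ) ≤ m := hm
  have hn' : (0 : ℤ) ≤ n := hn
  rw [loopBracket_single, Finsupp.single_apply, Finsupp.single_apply, Finsupp.single_apply]
  split_ifs <;> first | omega | simp

theorem loopDeg_apply (a : Loop) (n : ℤ) : loopDeg a n = (n : ℂ) • a n := by
  induction a using Finsupp.induction_linear with
  | zero => simp
  | add a a' h h' => simp [h, h']
  | single m x =>
    rw [loopDeg_single, Finsupp.smul_apply, Finsupp.single_apply]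
    split_ifs with h
    · rw [h]
    · simp

theorem loopDeg_mem_supported {s : Set ℤ} {a : Loop} (ha : a ∈ Finsupp.supported Sl2 ℂ s) :
    loopDeg a ∈ Finsupp.supported Sl2 ℂ s := by
  rw [Finsupp.mem_supported'] at ha ⊢
  intro n hn
  rw [loopDeg_apply, ha n hn, smul_zero]

/-- The loop elements with only negative powers of `t`. -/
def negModes : LieSubalgebra ℂ AffineSl2 where
  carrier := {a | a.loop ∈ Finsupp.supported Sl2 ℂ {n : ℤ | n < 0} ∧ a.cK = 0 ∧ a.cL = 0}
  add_mem' := by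
    rintro a b ⟨h3, h1, h2⟩ ⟨h3', h1', h2'⟩
    exact ⟨Submodule.add_mem _ h3 h3', by simp [h1, h1'], by simp [h2, h2']⟩
  zero_mem' := ⟨Submodule.zero_mem _, rfl, rfl⟩
  smul_mem' := by
    rintro c a ⟨h3, h1, h2⟩
    exact ⟨Submodule.smul_mem _ c h3, by simp [h1], by simp [h2]⟩
  lie_mem' := by
    rintro a b ⟨h3, h1, h2⟩ ⟨h3', h1', h2'⟩
    refine ⟨?_, loopCocycle_eq_zero (fun m (hm : m < 0) n (hn : n < 0) => by omega) h3 h3', rfl⟩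
    rw [loop_lie, h2, h2', zero_smul, zero_smul, sub_zero, add_zero]
    exact loopBracket_mem_supported
      (fun m (hm : m < 0) n (hn : n < 0) => show m + n < 0 by omega) h3 h3'

/-- The projection to the negative modes. -/
def negProj : AffineSl2 →ₗ[ℂ] negModes where
  toFun a := ⟨⟨a.loop.filter (· < 0), 0, 0⟩, by
    rw [Finsupp.mem_supported']
    exact fun n hn => Finsupp.filter_apply_neg _ _ hn, rfl, rfl⟩
  map_add' a b := by
    ext1
    ext1
    · exact Finsupp.filter_add
    · exact (add_zero 0).symm
    · exact (add_zero 0).symm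
  map_smul' c a := by
    ext1
    ext1
    · exact Finsupp.filter_smul
    · exact (smul_zero c).symm
    · exact (smul_zero c).symm

theorem negProj_coe (y : negModes) : negProj y = y := by
  obtain ⟨y, h3, h1, h2⟩ := y
  ext1
  ext1
  · rw [Finsupp.mem_supported'] at h3
    exact Finsupp.filter_eq_self_iff _ _ |>.mpr fun n hn => by
      by_contra h
      exact hn (h3 n h)
  · exact h1.symm
  · exact h2.symm

theorem mem_supported_of_negProj_eq_zero {a : AffineSl2} (h : negProj a = 0) :
    a.loop ∈ Finsupp.supported Sl2 ℂ {n : ℤ | 0 ≤ n} := by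
  have h1 : a.loop.filter (· < 0) = 0 := congrArg (fun y : negModes => (y : AffineSl2).loop) h
  rw [Finsupp.mem_supported']
  intro n hn
  have h2 := DFunLike.congr_fun h1 n
  rwa [Finsupp.filter_apply_pos (· < 0) _ (not_le.mp hn)] at h2

theorem negProj_eq_zero {a : AffineSl2} (h : a.loop ∈ Finsupp.supported Sl2 ℂ {n : ℤ | 0 ≤ n}) :
    negProj a = 0 := by
  rw [Finsupp.mem_supported'] at h
  ext1
  ext1
  · refine (Finsupp.filter_eq_zero_iff _ _).mpr fun n hn => h n (not_le.mpr hn)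
  · rfl
  · rfl

variable (k Δ : ℂ) (M : Type) [AddCommGroup M] [Module ℂ M] [LieRingModule Sl2 M]
  [LieModule ℂ Sl2 M]

/-- The action of the nonnegative modes, `K` and `L₀` on `M`. -/
def posAct : AffineSl2 →ₗ[ℂ] Module.End ℂ M where
  toFun a := LieModule.toEnd ℂ Sl2 M (a.loop 0) + (a.cK * k + a.cL * Δ) • 1
  map_add' a b := by
    simp only [loop_add, Finsupp.add_apply, map_add, cK_add, cL_add]; module
  map_smul' c a := by
    simp only [loop_smul, Finsupp.smul_apply, map_smul, cK_smul, cL_smul, smul_eq_mul,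
      RingHom.id_apply]
    module

theorem posAct_apply (a : AffineSl2) :
    posAct k Δ M a = LieModule.toEnd ℂ Sl2 M (a.loop 0) + (a.cK * k + a.cL * Δ) • 1 := rfl

theorem posAct_coe (y : negModes) : posAct k Δ M y = 0 := by
  obtain ⟨y, h3, h1, h2⟩ := y
  rw [Finsupp.mem_supported'] at h3
  have h4 : y.loop 0 = 0 := h3 0 (show ¬((0 : ℤ) < 0) from lt_irrefl 0)
  rw [posAct_apply]
  simp [h1, h2, h4]

/-- On the nonnegative part the cocycle vanishes, because only `m = n = 0` could contribute and it
carries the factor `m`. Bracketing with `L₀` multiplies the coefficient of `t⁰` by `0`, and the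
scalars drop out of commutators, so only evaluation at `t⁰` matters. -/
theorem posAct_lie (a b : AffineSl2) (ha : negProj a = 0) (hb : negProj b = 0) :
    negProj ⁅a, b⁆ = 0 ∧
      posAct k Δ M ⁅a, b⁆ = posAct k Δ M a * posAct k Δ M b - posAct k Δ M b * posAct k Δ M a := by
  have ha' := mem_supported_of_negProj_eq_zero ha
  have hb' := mem_supported_of_negProj_eq_zero hb
  constructor
  · apply negProj_eq_zero
    rw [loop_lie]
    refine Submodule.add_mem _ (Submodule.sub_mem _ (loopBracket_mem_supported
      (fun m (hm : 0 ≤ m) n (hn : 0 ≤ n) => show 0 ≤ m + n by omega) ha' hb') ?_) ?_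
    · exact Submodule.smul_mem _ _ (loopDeg_mem_supported hb')
    · exact Submodule.smul_mem _ _ (loopDeg_mem_supported ha')
  · have h1 : ⁅a, b⁆.loop 0 = ⁅a.loop 0, b.loop 0⁆ := by
      rw [loop_lie, Finsupp.add_apply, Finsupp.sub_apply, Finsupp.smul_apply, Finsupp.smul_apply,
        loopDeg_apply, loopDeg_apply, loopBracket_apply_zero ha' hb']
      simp
    have h2 : ⁅a, b⁆.cK = 0 :=
      loopCocycle_eq_zero (fun m (hm : 0 ≤ m) n (hn : 0 ≤ n) => by omega) ha' hb'
    have h3 : LieModule.toEnd ℂ Sl2 M ⁅a.loop 0, b.loop 0⁆ =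
        LieModule.toEnd ℂ Sl2 M (a.loop 0) * LieModule.toEnd ℂ Sl2 M (b.loop 0) -
          LieModule.toEnd ℂ Sl2 M (b.loop 0) * LieModule.toEnd ℂ Sl2 M (a.loop 0) :=
      LieHom.map_lie (LieModule.toEnd ℂ Sl2 M) _ _
    rw [posAct_apply, posAct_apply, posAct_apply, h1, h2, cL_lie, h3]
    simp only [add_mul, mul_add, smul_mul_assoc, mul_smul_comm, one_mul, mul_one]
    module

/-- The module `M` embeds in the relaxed Verma module induced from it. -/
theorem RelaxedVerma.ofBase_injective : Function.Injective (ofBase k Δ M) := by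
  -- The model `U(n) ⊗ M` separates ground states: the universal property gives a map to it that
  -- sends the class of `m` to `1 ⊗ m`.
  let ρ := indRep negProj (posAct k Δ M) negProj_coe (posAct_coe k Δ M) (posAct_lie k Δ M)
  let _ : LieRingModule AffineSl2 (IndSpace negModes M) := LieRingModule.compLieHom _ ρ
  have _ : LieModule ℂ AffineSl2 (IndSpace negModes M) := LieModule.compLieHom _ ρ
  let φ : M →ₗ[ℂ] IndSpace negModes M := TensorProduct.mk ℂ _ M 1
  have hlie (a : AffineSl2) (ha : a.loop ∈ Finsupp.supported Sl2 ℂ {n : ℤ | 0 ≤ n}) (m : M) :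
      ⁅a, φ m⁆ = φ (posAct k Δ M a m) := by
    change indAct negProj (posAct k Δ M) a (1 ⊗ₜ m) = _
    rw [indAct_one_tmul, negProj_eq_zero ha, map_zero, TensorProduct.zero_tmul, zero_add]; rfl
  have hmode (n : ℤ) (hn : 0 ≤ n) (x : Sl2) :
      (mode n x).loop ∈ Finsupp.supported Sl2 ℂ {n : ℤ | 0 ≤ n} :=
    Finsupp.single_mem_supported ℂ _ hn
  have hφ : IsGroundMap k Δ φ :=
    { zero_mode := fun x m => by
        rw [hlie _ (hmode 0 le_rfl x), posAct_apply]; simp [mode]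
      pos_mode := fun {n} hn x m => by
        rw [hlie _ (hmode n hn.le x), posAct_apply]
        simp [mode, hn.ne']
      central := fun m => by
        rw [hlie _ (Submodule.zero_mem _), posAct_apply]; simp [K]
      conformal := fun m => by
        rw [hlie _ (Submodule.zero_mem _), posAct_apply]; simp [L0] }
  intro m m' h
  have h1 := congrArg (lift hφ) h
  rw [lift_ofBase, lift_ofBase] at h1
  exact one_tmul_injective negModes M h1

end Embedding

/-! ## Weight space decompositions -/

/-- The basis element `e` of `sl₂`. -/
def sl2e : Sl2 := ⟨!![0, 1; 0, 0], LinearMap.mem_ker.mpr (by simp [Matrix.trace_fin_two])⟩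

/-- The basis element `h` of `sl₂`. -/
def sl2h : Sl2 := ⟨!![1, 0; 0, -1], LinearMap.mem_ker.mpr (by simp [Matrix.trace_fin_two])⟩

/-- The basis element `f` of `sl₂`. -/
def sl2f : Sl2 := ⟨!![0, 0; 1, 0], LinearMap.mem_ker.mpr (by simp [Matrix.trace_fin_two])⟩

theorem sl2_trace (x : Sl2) : x.1 1 1 = -x.1 0 0 := by
  have h : Matrix.trace x.1 = 0 := LinearMap.mem_ker.mp x.2
  rw [Matrix.trace_fin_two] at h
  linear_combination h

theorem sl2_eq (x : Sl2) : x = x.1 0 1 • sl2e + x.1 0 0 • sl2h + x.1 1 0 • sl2f := by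
  apply Subtype.ext
  ext i j
  fin_cases i <;> fin_cases j <;> simp [sl2e, sl2h, sl2f, sl2_trace x]

theorem sl2h_lie_sl2e : ⁅sl2h, sl2e⁆ = (2 : ℂ) • sl2e := by
  apply Subtype.ext
  ext i j
  fin_cases i <;> fin_cases j <;>
    simp [sl2e, sl2h, Ring.lie_def]
  norm_num

theorem sl2h_lie_sl2f : ⁅sl2h, sl2f⁆ = -((2 : ℂ) • sl2f) := by
  apply Subtype.ext
  ext i j
  fin_cases i <;> fin_cases j <;>
    simp [sl2f, sl2h, Ring.lie_def]
  norm_num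

theorem sl2e_lie_sl2f : ⁅sl2e, sl2f⁆ = sl2h := by
  apply Subtype.ext
  ext i j
  fin_cases i <;> fin_cases j <;>
    simp [sl2e, sl2f, sl2h, Ring.lie_def]

/-- The basis `e`, `h`, `f` of `sl₂`. -/
def sl2Basis : Fin 3 → Sl2 := ![sl2e, sl2h, sl2f]

/-- The weights of `e`, `h`, `f` as multiples of the simple root. -/
def sl2Shift : Fin 3 → ℤ := ![1, 0, -1]

theorem sl2h_lie_basis (t : Fin 3) :
    ⁅sl2h, sl2Basis t⁆ = (2 * (sl2Shift t : ℂ)) • sl2Basis t := by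
  fin_cases t
  · simpa [sl2Basis, sl2Shift] using sl2h_lie_sl2e
  · simp [sl2Basis, sl2Shift]
  · simpa [sl2Basis, sl2Shift] using sl2h_lie_sl2f

theorem mode_zero_lie_mode (n : ℤ) (x y : Sl2) : ⁅mode 0 x, mode n y⁆ = mode n ⁅x, y⁆ := by
  rw [mode_lie_mode]; simp

/-- An operator whose eigenspaces are the joint eigenspaces of `L₀` and `h`. -/
def weightOp : AffineSl2 := L0 + Complex.I • mode 0 sl2h

theorem weightOp_lie_basis (n : ℤ) (t : Fin 3) : ⁅weightOp, mode n (sl2Basis t)⁆ =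
    (-(n : ℂ) + Complex.I * (2 * sl2Shift t)) • mode n (sl2Basis t) := by
  rw [weightOp, add_lie, smul_lie, L0_lie_mode, mode_zero_lie_mode, sl2h_lie_basis, mode_smul]
  module

section Decomposition

variable (k Δ lam : ℂ) {M N : Type} [AddCommGroup M] [Module ℂ M] [LieRingModule Sl2 M]
  [LieModule ℂ Sl2 M] [AddCommGroup N] [Module ℂ N] [LieRingModule AffineSl2 N]
  [LieModule ℂ AffineSl2 N]

/-- A decomposition of an `sl₂`-module into finite-dimensional weight spaces of weights
`lam + 2 j`. -/
structure IsWeightDecomp (P : ℤ → Submodule ℂ M) : Prop where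
  fin : ∀ j, FiniteDimensional ℂ (P j)
  wt : ∀ {j m}, m ∈ P j → ⁅sl2h, m⁆ = (lam + 2 * j) • m
  top : ⨆ j, P j = ⊤

variable (N) in
/-- The space of vectors of conformal weight `Δ + d` and `sl₂`-weight `lam + 2 j`. -/
def wtSpace (i : ℕ × ℤ) : Submodule ℂ N :=
  Module.End.eigenspace (LieModule.toEnd ℂ AffineSl2 N weightOp)
    (Δ + i.1 + Complex.I * (lam + 2 * i.2))

variable {k Δ lam}

theorem mem_wtSpace {i : ℕ × ℤ} {w : N} : w ∈ wtSpace Δ lam N i ↔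
    ⁅weightOp, w⁆ = (Δ + i.1 + Complex.I * (lam + 2 * i.2)) • w :=
  Module.End.mem_eigenspace_iff

/-- The span of the monomials in negative modes applied to `φ(P j')` that have degree `d` and
weight shift `j`. -/
def monomials (φ : M →ₗ[ℂ] N) (P : ℤ → Submodule ℂ M) : ℕ → ℤ → Submodule ℂ N
  | 0, j => (P j).map φ
  -- The leftmost mode has degree `i + 1 ≥ 1`, so the remaining degree `d - i` is smaller. The
  -- factors are not ordered: only spanning and finite dimension are needed, not independence.
  | d + 1, j => ⨆ i : Fin (d + 1), ⨆ t : Fin 3, (monomials φ P (d - i) (j - sl2Shift t)).map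
      (LieModule.toEnd ℂ AffineSl2 N (mode (-((i : ℕ) + 1 : ℤ)) (sl2Basis t)))
  termination_by d => d

variable {φ : M →ₗ[ℂ] N} {P : ℤ → Submodule ℂ M}

theorem monomials_zero (j : ℤ) : monomials φ P 0 j = (P j).map φ := by rw [monomials]

theorem monomials_succ (d : ℕ) (j : ℤ) : monomials φ P (d + 1) j =
    ⨆ i : Fin (d + 1), ⨆ t : Fin 3, (monomials φ P (d - i) (j - sl2Shift t)).map
      (LieModule.toEnd ℂ AffineSl2 N (mode (-((i : ℕ) + 1 : ℤ)) (sl2Basis t))) := by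
  rw [monomials]

theorem monomials_induction {motive : ℕ → ℤ → N → Prop}
    (base : ∀ j m, m ∈ P j → motive 0 j (φ m))
    (step : ∀ (i d : ℕ) (j : ℤ) (t : Fin 3) (w : N), w ∈ monomials φ P d j →
      (∀ d' ≤ d, ∀ j', ∀ w ∈ monomials φ P d' j', motive d' j' w) →
      motive (d + i + 1) (j + sl2Shift t) ⁅mode (-((i : ℕ) + 1 : ℤ)) (sl2Basis t), w⁆)
    (zero : ∀ d j, motive d j 0)
    (add : ∀ d j w w', motive d j w → motive d j w' → motive d j (w + w'))
    {d : ℕ} {j : ℤ} {w : N} (hw : w ∈ monomials φ P d j) : motive d j w := by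
  induction d using Nat.strong_induction_on generalizing j w with
  | _ d ih =>
  rcases d with _ | d
  · rw [monomials_zero] at hw
    obtain ⟨m, hm, rfl⟩ := hw
    exact base j m hm
  · rw [monomials_succ] at hw
    induction hw using Submodule.iSup_induction' with
    | zero => exact zero _ _
    | add w w' _ _ h h' => exact add _ _ _ _ h h'
    | mem i w hw =>
      induction hw using Submodule.iSup_induction' with
      | zero => exact zero _ _
      | add w w' _ _ h h' => exact add _ _ _ _ h h'
      | mem t w hw =>
        obtain ⟨w, hw, rfl⟩ := hw
        have h := step i (d - i) (j - sl2Shift t) t w hw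
          fun d' hd' j' w' hw' => ih d' (by omega) hw'
        rwa [Nat.sub_add_cancel (Nat.lt_succ_iff.mp i.2), sub_add_cancel] at h

theorem lie_mem_monomials (i d : ℕ) (j : ℤ) (t : Fin 3) {w : N} (hw : w ∈ monomials φ P d j) :
    ⁅mode (-((i : ℕ) + 1 : ℤ)) (sl2Basis t), w⁆ ∈ monomials φ P (d + i + 1) (j + sl2Shift t) := by
  rw [monomials_succ]
  refine Submodule.mem_iSup_of_mem (⟨i, by omega⟩ : Fin (d + i + 1))
    (Submodule.mem_iSup_of_mem t ⟨w, ?_, rfl⟩)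
  simpa using hw

theorem finiteDimensional_monomials (hP : ∀ j, FiniteDimensional ℂ (P j)) (d : ℕ) (j : ℤ) :
    FiniteDimensional ℂ (monomials φ P d j) := by
  induction d using Nat.strong_induction_on generalizing j with
  | _ d ih =>
  rcases d with _ | d
  · rw [monomials_zero]; infer_instance
  · rw [monomials_succ]
    have (i : Fin (d + 1)) (t : Fin 3) :
        FiniteDimensional ℂ (monomials φ P (d - i) (j - sl2Shift t)) := ih _ (by omega) _
    infer_instance

theorem L0_lie_monomials (hφ : IsGroundMap k Δ φ) {d : ℕ} {j : ℤ} {w : N}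
    (hw : w ∈ monomials φ P d j) : ⁅L0, w⁆ = (Δ + d) • w := by
  refine monomials_induction (motive := fun d _ w => ⁅L0, w⁆ = (Δ + d) • w)
    (fun j m hm => ?_) (fun i d j t w hw ih => ?_) (fun d j => ?_) (fun d j w w' h h' => ?_) hw
  · rw [hφ.conformal]; simp
  · rw [leibniz_lie, L0_lie_mode, ih d le_rfl j w hw, smul_lie, lie_smul]
    push_cast
    module
  · simp
  · rw [lie_add, h, h', smul_add]

theorem sl2h_lie_monomials (hφ : IsGroundMap k Δ φ) (hP : IsWeightDecomp lam P) {d : ℕ} {j : ℤ}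
    {w : N} (hw : w ∈ monomials φ P d j) : ⁅mode 0 sl2h, w⁆ = (lam + 2 * j) • w := by
  refine monomials_induction (motive := fun _ j w => ⁅mode 0 sl2h, w⁆ = (lam + 2 * j) • w)
    (fun j m hm => ?_) (fun i d j t w hw ih => ?_) (fun d j => ?_) (fun d j w w' h h' => ?_) hw
  · rw [hφ.zero_mode, hP.wt hm, map_smul]
  · rw [leibniz_lie, mode_zero_lie_mode, sl2h_lie_basis, mode_smul, ih d le_rfl j w hw, smul_lie,
      lie_smul]
    push_cast
    module
  · simp
  · rw [lie_add, h, h', smul_add]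

theorem monomials_le_wtSpace (hφ : IsGroundMap k Δ φ) (hP : IsWeightDecomp lam P) (i : ℕ × ℤ) :
    monomials φ P i.1 i.2 ≤ wtSpace Δ lam N i := by
  intro w hw
  rw [mem_wtSpace, weightOp, add_lie, smul_lie, L0_lie_monomials hφ hw,
    sl2h_lie_monomials hφ hP hw]
  module

/-- As `K` is central, its `k`-eigenspace is a submodule, and it contains the generators. -/
theorem K_lie_eq (hφ : IsGroundMap k Δ φ) (hgen : Generates φ) (w : N) : ⁅K, w⁆ = k • w := by
  let S : LieSubmodule ℂ AffineSl2 N :=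
    { LinearMap.ker (LieModule.toEnd ℂ AffineSl2 N K - k • 1) with
      lie_mem := fun {a w} hw => by
        have h : ⁅K, w⁆ - k • w = 0 := hw
        change ⁅K, ⁅a, w⁆⁆ - k • ⁅a, w⁆ = 0
        rw [leibniz_lie, K_lie, zero_lie, zero_add, ← lie_smul, ← lie_sub, h, lie_zero] }
  have h : w ∈ S := by
    rw [hgen S fun m => ?_]; · exact LieSubmodule.mem_top w
    change ⁅K, φ m⁆ - k • φ m = 0
    rw [hφ.central, sub_self]
  exact sub_eq_zero.mp h

/-- The span of the monomials is stable under all modes. Negative modes lengthen a monomial; the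
others are commuted past its leftmost factor, by induction, until they reach the ground states,
where they act through `sl₂` or by zero. -/
theorem iSup_monomials (hφ : IsGroundMap k Δ φ) (hgen : Generates φ) (hP : IsWeightDecomp lam P) :
    ⨆ i : ℕ × ℤ, monomials φ P i.1 i.2 = ⊤ := by
  set S := ⨆ i : ℕ × ℤ, monomials φ P i.1 i.2 with hS
  have hmem {d j w} (hw : w ∈ monomials φ P d j) : w ∈ S :=
    Submodule.mem_iSup_of_mem (p := fun i : ℕ × ℤ => monomials φ P i.1 i.2) (d, j) hw
  have hbase (m : M) : φ m ∈ S := by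
    have hm : m ∈ ⨆ j, P j := hP.top ▸ Submodule.mem_top
    induction hm using Submodule.iSup_induction' with
    | zero => rw [map_zero]; exact S.zero_mem
    | add m m' _ _ h h' => rw [map_add]; exact S.add_mem h h'
    | mem j m hm => exact hmem (d := 0) (j := j) (by rw [monomials_zero]; exact ⟨m, hm, rfl⟩)
  have hext {n : ℤ} {w : N} (h : ∀ t, ⁅mode n (sl2Basis t), w⁆ ∈ S) (x : Sl2) :
      ⁅mode n x, w⁆ ∈ S := by
    rw [sl2_eq x, mode_add, mode_add, mode_smul, mode_smul, mode_smul, add_lie, add_lie, smul_lie,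
      smul_lie, smul_lie]
    exact S.add_mem (S.add_mem (S.smul_mem _ (h 0)) (S.smul_mem _ (h 1))) (S.smul_mem _ (h 2))
  have hspan {a : AffineSl2} (h : ∀ d j, ∀ w ∈ monomials φ P d j, ⁅a, w⁆ ∈ S) {w : N}
      (hw : w ∈ S) : ⁅a, w⁆ ∈ S := by
    rw [hS] at hw
    induction hw using Submodule.iSup_induction' with
    | zero => rw [lie_zero]; exact S.zero_mem
    | add m m' _ _ h h' => rw [lie_add]; exact S.add_mem h h'
    | mem i m hm => exact h i.1 i.2 m hm
  have hneg (i : ℕ) {w : N} (hw : w ∈ S) (x : Sl2) : ⁅mode (-((i : ℕ) + 1 : ℤ)) x, w⁆ ∈ S :=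
    hext (fun t => hspan (fun d j w hw => hmem (lie_mem_monomials i d j t hw)) hw) x
  -- A negative `n` is `-(i + 1)` with `i = -n - 1`.
  have hneg' {n : ℤ} (hn : n < 0) {w : N} (hw : w ∈ S) (x : Sl2) : ⁅mode n x, w⁆ ∈ S := by
    have := hneg (-n - 1).toNat hw x
    rwa [show -(((-n - 1).toNat : ℤ) + 1) = n by omega] at this
  have hmodes : ∀ {d j w}, w ∈ monomials φ P d j → ∀ n x, ⁅mode n x, w⁆ ∈ S := by
    intro d j w hw
    refine monomials_induction (motive := fun _ _ w => ∀ n x, ⁅mode n x, w⁆ ∈ S)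
      (fun j m hm n x => ?_) (fun i d j t w hw ih n x => ?_) (fun d j n x => ?_)
      (fun d j w w' h h' n x => ?_) hw
    · rcases lt_trichotomy n 0 with hn | rfl | hn
      · exact hneg' hn (hbase m) x
      · rw [hφ.zero_mode]; exact hbase _
      · rw [hφ.pos_mode hn]; exact S.zero_mem
    · rw [leibniz_lie, mode_lie_mode, add_lie, smul_lie, K_lie_eq hφ hgen]
      refine S.add_mem (S.add_mem (ih d le_rfl j w hw _ _) ?_) ?_
      · exact S.smul_mem _ (S.smul_mem _ (hmem hw))
      · exact hneg i (ih d le_rfl j w hw n x) _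
    · rw [lie_zero]; exact S.zero_mem
    · rw [lie_add]; exact S.add_mem (h n x) (h' n x)
  let S' : LieSubmodule ℂ AffineSl2 N :=
    { S with
      lie_mem := fun {a w} hw => by
        refine lie_mem_of_modes (fun n x => hspan (fun d j w hw => hmodes hw n x) hw) ?_ ?_ a
        · rw [K_lie_eq hφ hgen]; exact S.smul_mem _ hw
        · refine hspan (fun d j w hw => ?_) hw
          rw [L0_lie_monomials hφ hw]; exact S.smul_mem _ (hmem hw) }
  have h := hgen S' hbase
  rw [eq_top_iff]
  intro w _
  have : w ∈ S' := h ▸ LieSubmodule.mem_top w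
  exact this

/-- The complex numbers `Δ` and `lam` cancel in a difference of two eigenvalues. What remains has
the difference of degrees as real part and twice the difference of weight indices as imaginary part,
so a single operator separates both gradings. -/
theorem weight_injective (Δ lam : ℂ) : Function.Injective fun i : ℕ × ℤ =>
    Δ + (i.1 : ℂ) + Complex.I * (lam + 2 * (i.2 : ℂ)) := by
  intro i i' h
  have h1 : ((i.1 : ℂ) - i'.1) + Complex.I * (2 * (i.2 - i'.2)) = 0 := by linear_combination h
  have hre := congrArg Complex.re h1
  have him := congrArg Complex.im h1
  simp at hre him
  ext
  · have : (i.1 : ℝ) = i'.1 := by linarith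
    exact_mod_cast this
  · have : (i.2 : ℝ) = i'.2 := by linarith
    exact_mod_cast this

variable (Δ lam N) in
theorem iSupIndep_wtSpace : iSupIndep (wtSpace Δ lam N) :=
  (Module.End.eigenspaces_iSupIndep (LieModule.toEnd ℂ AffineSl2 N weightOp)).comp
    (weight_injective Δ lam)

/-- Weight spaces are independent, so subspaces of them that already span everything must fill them.
-/
theorem wtSpace_eq_of_le {A : ℕ × ℤ → Submodule ℂ N} (h : ∀ i, A i ≤ wtSpace Δ lam N i)
    (htop : ⨆ i, A i = ⊤) (i : ℕ × ℤ) : wtSpace Δ lam N i = A i :=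
  (congrFun (((iSupIndep_wtSpace Δ lam N).le_iff_eq_of_iSup_eq_top htop).mp h) i).symm

theorem wtSpace_eq_monomials (hφ : IsGroundMap k Δ φ) (hgen : Generates φ)
    (hP : IsWeightDecomp lam P) (i : ℕ × ℤ) : wtSpace Δ lam N i = monomials φ P i.1 i.2 :=
  wtSpace_eq_of_le (monomials_le_wtSpace hφ hP) (iSup_monomials hφ hgen hP) i

theorem iSup_wtSpace (hφ : IsGroundMap k Δ φ) (hgen : Generates φ)
    (hP : IsWeightDecomp lam P) : ⨆ i, wtSpace Δ lam N i = ⊤ := by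
  rw [← iSup_monomials hφ hgen hP]
  exact iSup_congr (wtSpace_eq_monomials hφ hgen hP)

theorem finiteDimensional_wtSpace (hφ : IsGroundMap k Δ φ) (hgen : Generates φ)
    (hP : IsWeightDecomp lam P) (i : ℕ × ℤ) : FiniteDimensional ℂ (wtSpace Δ lam N i) := by
  rw [wtSpace_eq_monomials hφ hgen hP]
  exact finiteDimensional_monomials hP.fin _ _

theorem range_eq_iSup_wtSpace (hφ : IsGroundMap k Δ φ) (hgen : Generates φ)
    (hP : IsWeightDecomp lam P) : LinearMap.range φ = ⨆ i ∈ {i : ℕ × ℤ | i.1 = 0},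
      wtSpace Δ lam N i := by
  rw [LinearMap.range_eq_map, ← hP.top, Submodule.map_iSup]
  apply le_antisymm
  · refine iSup_le fun j => ?_
    refine le_trans (le_of_eq ?_) (le_iSup₂_of_le (0, j) rfl le_rfl)
    rw [wtSpace_eq_monomials hφ hgen hP, monomials_zero]
  · refine iSup₂_le ?_
    rintro ⟨_, j⟩ rfl
    rw [wtSpace_eq_monomials hφ hgen hP, monomials_zero]
    exact le_iSup (fun j => (P j).map φ) j

theorem wtSpace_shift {i : ℕ × ℤ} {w : N} (hw : w ∈ wtSpace Δ lam N i) (t : Fin 3) :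
    ⁅mode 0 (sl2Basis t), w⁆ ∈ wtSpace Δ lam N (i.1, i.2 + sl2Shift t) := by
  rw [mem_wtSpace] at hw ⊢
  rw [leibniz_lie, weightOp_lie_basis, hw, smul_lie, lie_smul]
  push_cast
  module

variable {N' : Type} [AddCommGroup N'] [Module ℂ N'] [LieRingModule AffineSl2 N']
  [LieModule ℂ AffineSl2 N']

theorem map_mem_wtSpace (g : N →ₗ⁅ℂ, AffineSl2⁆ N') {i : ℕ × ℤ} {w : N}
    (hw : w ∈ wtSpace Δ lam N i) : g w ∈ wtSpace Δ lam N' i := by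
  rw [mem_wtSpace] at hw ⊢
  rw [← LieModuleHom.map_lie, hw, map_smul]

/-- The kernel of a homomorphism is graded by weights. -/
theorem exists_weight_components (htop : ⨆ i, wtSpace Δ lam N i = ⊤)
    (g : N →ₗ⁅ℂ, AffineSl2⁆ N') {w : N} (hw : g w = 0) :
    ∃ v : ℕ × ℤ →₀ N, (∀ i, v i ∈ wtSpace Δ lam N i ∧ g (v i) = 0) ∧ (v.sum fun _ x => x) = w := by
  have h : w ∈ ⨆ i, wtSpace Δ lam N i := htop ▸ Submodule.mem_top
  obtain ⟨v, hv, rfl⟩ := (Submodule.mem_iSup_iff_exists_finsupp _ _).mp h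
  refine ⟨v, fun i => ⟨hv i, ?_⟩, rfl⟩
  by_cases hi : i ∈ v.support
  · rw [Finsupp.sum, map_sum] at hw
    -- The vectors `g (v i)` lie in independent weight spaces and add up to zero.
    exact (iSupIndep_iff_finsetSum_eq_zero_imp_eq_zero _).mp (iSupIndep_wtSpace Δ lam N')
      v.support (fun i => g (v i)) (fun i _ => map_mem_wtSpace g (hv i)) hw i hi
  · rw [Finsupp.notMem_support_iff.mp hi, map_zero]

end Decomposition

/-! ## Submodules that avoid the ground states -/

section Radical

variable {k Δ lam : ℂ} {M N : Type} [AddCommGroup M] [Module ℂ M] [LieRingModule Sl2 M]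
  [LieModule ℂ Sl2 M] [AddCommGroup N] [Module ℂ N] [LieRingModule AffineSl2 N]
  [LieModule ℂ AffineSl2 N] {φ : M →ₗ[ℂ] N} {P : ℤ → Submodule ℂ M}

variable (Δ lam N) in
/-- The sum of the weight spaces of conformal weight different from `Δ`. -/
def posPart : Submodule ℂ N := ⨆ i ∈ {i : ℕ × ℤ | i.1 ≠ 0}, wtSpace Δ lam N i

theorem map_mem_posPart {N' : Type} [AddCommGroup N'] [Module ℂ N'] [LieRingModule AffineSl2 N']
    [LieModule ℂ AffineSl2 N'] (g : N →ₗ⁅ℂ, AffineSl2⁆ N') {w : N} (hw : w ∈ posPart Δ lam N) :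
    g w ∈ posPart Δ lam N' := by
  suffices h : posPart Δ lam N ≤ (posPart Δ lam N').comap (g : N →ₗ[ℂ] N') from h hw
  exact iSup₂_le fun i hi w hw =>
    Submodule.mem_iSup_of_mem i (Submodule.mem_iSup_of_mem hi (map_mem_wtSpace g hw))

/-- A submodule avoids the ground states if and only if it has only positive degrees. -/
theorem inf_range_eq_bot_iff (hφ : IsGroundMap k Δ φ) (hgen : Generates φ)
    (hP : IsWeightDecomp lam P) (I : LieSubmodule ℂ AffineSl2 N) :
    I.toSubmodule ⊓ LinearMap.range φ = ⊥ ↔ I.toSubmodule ≤ posPart Δ lam N := by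
  rw [range_eq_iSup_wtSpace hφ hgen hP]
  constructor
  · intro h w hw
    -- The submodule `I` is the kernel of its quotient map, hence graded.
    obtain ⟨v, hv, rfl⟩ := exists_weight_components (iSup_wtSpace hφ hgen hP)
      (LieSubmodule.Quotient.mk' I) ((LieSubmodule.Quotient.mk_eq_zero (N := I)).mpr hw)
    refine Submodule.sum_mem _ fun i _ => ?_
    obtain ⟨h1, h2⟩ := hv i
    rw [LieSubmodule.Quotient.mk_eq_zero] at h2
    by_cases hi : i.1 = 0
    · have h3 : v i ∈ I.toSubmodule ⊓ ⨆ i ∈ {i : ℕ × ℤ | i.1 = 0}, wtSpace Δ lam N i :=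
        ⟨h2, Submodule.mem_iSup_of_mem i (Submodule.mem_iSup_of_mem hi h1)⟩
      rw [h, Submodule.mem_bot] at h3
      change v i ∈ _
      rw [h3]; exact Submodule.zero_mem _
    · exact Submodule.mem_iSup_of_mem i (Submodule.mem_iSup_of_mem hi h1)
  · intro h
    have hd : Disjoint (⨆ i ∈ {i : ℕ × ℤ | i.1 ≠ 0}, wtSpace Δ lam N i)
        (⨆ i ∈ {i : ℕ × ℤ | i.1 = 0}, wtSpace Δ lam N i) :=
      (iSupIndep_wtSpace Δ lam N).disjoint_biSup_biSup
        (Set.disjoint_left.mpr fun i hi hi' => hi hi')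
    exact (hd.mono_left h).eq_bot

variable (φ) in
/-- `J` is the largest submodule that avoids the ground states. -/
def IsTopRadical (J : LieSubmodule ℂ AffineSl2 N) : Prop :=
  ∀ I : LieSubmodule ℂ AffineSl2 N, I ≤ J ↔ I.toSubmodule ⊓ LinearMap.range φ = ⊥

/-- Trivial intersection with the ground states is not visibly stable under sums, but lying in
positive degrees is; the grading translates one into the other. -/
theorem isTopRadical_sSup (hφ : IsGroundMap k Δ φ) (hgen : Generates φ)
    (hP : IsWeightDecomp lam P) :
    IsTopRadical φ (sSup {I | I.toSubmodule ⊓ LinearMap.range φ = ⊥}) := by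
  intro I
  rw [inf_range_eq_bot_iff hφ hgen hP]
  constructor
  · intro h
    have h1 : (sSup {I : LieSubmodule ℂ AffineSl2 N |
        I.toSubmodule ⊓ LinearMap.range φ = ⊥}).toSubmodule ≤ posPart Δ lam N := by
      rw [LieSubmodule.sSup_toSubmodule]
      refine sSup_le ?_
      rintro _ ⟨I', hI', rfl⟩
      exact (inf_range_eq_bot_iff hφ hgen hP I').mp hI'
    exact le_trans h h1
  · intro h
    exact le_sSup ((inf_range_eq_bot_iff hφ hgen hP I).mpr h)

variable (k Δ φ) in
/-- The affine module `N` is generated by its ground states, which form the `sl₂`-module `M`, and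
every nonzero submodule contains nonzero ground states. -/
structure IsTopModule : Prop where
  ground : IsGroundMap k Δ φ
  gen : Generates φ
  inj : Function.Injective φ
  faithful : ∀ I : LieSubmodule ℂ AffineSl2 N, I.toSubmodule ⊓ LinearMap.range φ = ⊥ → I = ⊥

variable (φ) in
/-- The map from `M` to a quotient of `N`. -/
def quotBase (J : LieSubmodule ℂ AffineSl2 N) : M →ₗ[ℂ] N ⧸ J :=
  (LieSubmodule.Quotient.mk' J : N →ₗ[ℂ] N ⧸ J) ∘ₗ φ

theorem quotBase_apply (J : LieSubmodule ℂ AffineSl2 N) (m : M) :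
    quotBase φ J m = LieSubmodule.Quotient.mk' J (φ m) := rfl

/-- A submodule of the quotient that avoids the ground states pulls back to one that avoids them in
`N`, hence into `J`. -/
theorem isTopModule_quotBase (hφ : IsGroundMap k Δ φ) (hgen : Generates φ)
    (hinj : Function.Injective φ) {J : LieSubmodule ℂ AffineSl2 N} (hJ : IsTopRadical φ J) :
    IsTopModule k Δ (quotBase φ J) := by
  have hzero {m : M} (hm : φ m ∈ J) : φ m = 0 := by
    have h : φ m ∈ J.toSubmodule ⊓ LinearMap.range φ := ⟨hm, m, rfl⟩
    rwa [(hJ J).mp le_rfl, Submodule.mem_bot] at h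
  refine ⟨hφ.comp _, hgen.comp (LieSubmodule.Quotient.surjective_mk' J), ?_, fun I hI => ?_⟩
  · rw [injective_iff_map_eq_zero]
    intro m hm
    rw [quotBase_apply, LieSubmodule.Quotient.mk_eq_zero] at hm
    exact (injective_iff_map_eq_zero φ).mp hinj m (hzero hm)
  · have h1 : I.comap (LieSubmodule.Quotient.mk' J) ≤ J := by
      rw [hJ, eq_bot_iff]
      rintro _ ⟨hw, m, rfl⟩
      have h2 : quotBase φ J m ∈ I.toSubmodule ⊓ LinearMap.range (quotBase φ J) := ⟨hw, m, rfl⟩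
      rw [hI, Submodule.mem_bot, quotBase_apply, LieSubmodule.Quotient.mk_eq_zero] at h2
      exact hzero h2
    rw [eq_bot_iff]
    intro y hy
    obtain ⟨w, rfl⟩ := LieSubmodule.Quotient.surjective_mk' J y
    rw [LieSubmodule.mem_bot, LieSubmodule.Quotient.mk_eq_zero]
    exact h1 hy

/-- A submodule that contains a ground state contains all of them if they form a simple module. -/
theorem eq_top_of_inf_range_ne_bot (hφ : IsGroundMap k Δ φ) (hgen : Generates φ)
    (hM : ∀ S : LieSubmodule ℂ Sl2 M, S = ⊥ ∨ S = ⊤) {I : LieSubmodule ℂ AffineSl2 N}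
    (hI : I.toSubmodule ⊓ LinearMap.range φ ≠ ⊥) : I = ⊤ := by
  let S : LieSubmodule ℂ Sl2 M :=
    { I.toSubmodule.comap φ with
      lie_mem := fun {x m} hm => by
        change φ ⁅x, m⁆ ∈ I
        rw [← hφ.zero_mode]
        exact I.lie_mem hm }
  rcases hM S with h | h
  · refine absurd ?_ hI
    rw [eq_bot_iff]
    rintro _ ⟨hm, m, rfl⟩
    have : m ∈ S := hm
    rw [h, LieSubmodule.mem_bot] at this
    rw [this, map_zero]
    exact Submodule.zero_mem _
  · refine hgen I fun m => ?_
    have : m ∈ S := h ▸ LieSubmodule.mem_top m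
    exact this

theorem isIrreducible_of_isTopModule [Nontrivial M] (hφ : IsTopModule k Δ φ)
    (hM : ∀ S : LieSubmodule ℂ Sl2 M, S = ⊥ ∨ S = ⊤) : LieModule.IsIrreducible ℂ AffineSl2 N := by
  have : Nontrivial N := hφ.inj.nontrivial
  exact LieModule.IsIrreducible.mk fun I hI =>
    eq_top_of_inf_range_ne_bot hφ.ground hφ.gen hM fun h => hI (hφ.faithful I h)

/-- If the ground states form a simple module, a submodule is proper exactly when it avoids them.
Thus the simple quotient and the quotient by the ground radical are the same construction. -/
theorem isTopRadical_maxProper [Nontrivial M] (hφ : IsGroundMap k Δ φ) (hgen : Generates φ)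
    (hinj : Function.Injective φ) (hP : IsWeightDecomp lam P)
    (hM : ∀ S : LieSubmodule ℂ Sl2 M, S = ⊥ ∨ S = ⊤) : IsTopRadical φ (maxProper N) := by
  have h : {I : LieSubmodule ℂ AffineSl2 N | I ≠ ⊤} =
      {I | I.toSubmodule ⊓ LinearMap.range φ = ⊥} := by
    ext I
    constructor
    · intro hI
      by_contra h
      exact hI (eq_top_of_inf_range_ne_bot hφ hgen hM h)
    · rintro hI rfl
      obtain ⟨m, hm⟩ := exists_ne (0 : M)
      have h1 : φ m ∈ (⊤ : LieSubmodule ℂ AffineSl2 N).toSubmodule ⊓ LinearMap.range φ :=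
        ⟨trivial, m, rfl⟩
      rw [hI, Submodule.mem_bot] at h1
      exact hm ((injective_iff_map_eq_zero φ).mp hinj m h1)
  rw [maxProper, h]
  exact isTopRadical_sSup hφ hgen hP

/-- The weight spaces grouped by `L₀`-eigenvalue lie in the generalised eigenspaces and span
everything, so independence of the latter forces equality. -/
theorem maxGenEigenspace_actL0 (hφ : IsGroundMap k Δ φ) (hgen : Generates φ)
    (hP : IsWeightDecomp lam P) (c : ℂ) : (actL0 N).maxGenEigenspace c =
      ⨆ i : {i : ℕ × ℤ // Δ + i.1 = c}, wtSpace Δ lam N i := by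
  refine (congrFun (((Module.End.independent_maxGenEigenspace (actL0 N)).le_iff_eq_of_iSup_eq_top
    (f := fun c => ⨆ i : {i : ℕ × ℤ // Δ + i.1 = c}, wtSpace Δ lam N i) ?_).mp
    fun c => ?_) c).symm
  · rw [eq_top_iff, ← iSup_wtSpace hφ hgen hP]
    exact iSup_le fun i => le_iSup_of_le (Δ + i.1) (le_iSup_of_le ⟨i, rfl⟩ le_rfl)
  · refine iSup_le ?_
    rintro ⟨i, rfl⟩ w hw
    refine Module.End.eigenspace_le_maxGenEigenspace ?_
    rw [wtSpace_eq_monomials hφ hgen hP] at hw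
    exact Module.End.mem_eigenspace_iff.mpr (L0_lie_monomials hφ hw)

/-- Every eigenvalue of `L₀` is `Δ + n` with `n` natural, and `Δ` occurs because `M` is nonzero; so
minimal real part singles out `n = 0`. Numbers that are not eigenvalues contribute nothing to the
supremum. -/
theorem groundStates_eq [Nontrivial M] (hφ : IsGroundMap k Δ φ) (hgen : Generates φ)
    (hinj : Function.Injective φ) (hP : IsWeightDecomp lam P) :
    groundStates N = LinearMap.range φ := by
  rw [range_eq_iSup_wtSpace hφ hgen hP, groundStates]
  apply le_antisymm
  · refine iSup₂_le fun c hc => ?_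
    have hΔ : (actL0 N).HasEigenvalue Δ := by
      obtain ⟨m, hm⟩ := exists_ne (0 : M)
      exact Module.End.hasEigenvalue_of_hasEigenvector
        (x := φ m) ⟨Module.End.mem_eigenspace_iff.mpr (hφ.conformal m),
          fun h => hm ((injective_iff_map_eq_zero φ).mp hinj m h)⟩
    rw [maxGenEigenspace_actL0 hφ hgen hP]
    refine iSup_le ?_
    rintro ⟨i, rfl⟩
    refine le_iSup₂_of_le i ?_ le_rfl
    have := hc Δ hΔ
    simp only [Complex.add_re, Complex.natCast_re, add_le_iff_nonpos_right] at this
    exact_mod_cast le_antisymm this (Nat.cast_nonneg _)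
  · refine iSup₂_le fun i (hi : i.1 = 0) => le_iSup₂_of_le Δ ?_ ?_
    · intro c hc
      have h1 : (actL0 N).maxGenEigenspace c ≠ ⊥ := fun h =>
        hc (eq_bot_iff.mpr (le_trans Module.End.eigenspace_le_maxGenEigenspace h.le))
      rw [maxGenEigenspace_actL0 hφ hgen hP] at h1
      rcases isEmpty_or_nonempty {i : ℕ × ℤ // Δ + i.1 = c} with he | ⟨⟨i, rfl⟩⟩
      · exact absurd (iSup_of_empty _) h1
      · simp
    · rw [maxGenEigenspace_actL0 hφ hgen hP]
      exact le_iSup_of_le (⟨i, by simp [hi]⟩ : {i : ℕ × ℤ // Δ + i.1 = Δ}) le_rfl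

theorem isTopRadical_groundRadical [Nontrivial M] (hφ : IsGroundMap k Δ φ) (hgen : Generates φ)
    (hinj : Function.Injective φ) (hP : IsWeightDecomp lam P) :
    IsTopRadical φ (groundRadical N) := by
  rw [groundRadical, groundStates_eq hφ hgen hinj hP]
  exact isTopRadical_sSup hφ hgen hP

end Radical

/-! ### Functoriality in the module of ground states -/

section Functoriality

open RelaxedVerma

variable {k Δ lam : ℂ} {M M' N' : Type} [AddCommGroup M] [Module ℂ M] [LieRingModule Sl2 M]
  [LieModule ℂ Sl2 M] [AddCommGroup M'] [Module ℂ M'] [LieRingModule Sl2 M']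
  [LieModule ℂ Sl2 M'] [AddCommGroup N'] [Module ℂ N'] [LieRingModule AffineSl2 N']
  [LieModule ℂ AffineSl2 N'] {P : ℤ → Submodule ℂ M} {P' : ℤ → Submodule ℂ M'}
  {φ' : M' →ₗ[ℂ] N'} {J : LieSubmodule ℂ AffineSl2 (RelaxedVerma k Δ M)}

theorem IsGroundMap.precomp (hφ : IsGroundMap k Δ φ') (g : M →ₗ⁅ℂ, Sl2⁆ M') :
    IsGroundMap k Δ (φ' ∘ₗ (g : M →ₗ[ℂ] M')) where
  zero_mode x m := by simp [hφ.zero_mode]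
  pos_mode hn x m := hφ.pos_mode hn x _
  central m := hφ.central _
  conformal m := hφ.conformal _

/-- The affine module map induced by a homomorphism between the modules of ground states. -/
theorem exists_quotMap (hP : IsWeightDecomp lam P) (hP' : IsWeightDecomp lam P')
    (hJ : IsTopRadical (ofBase k Δ M) J) (hφ' : IsTopModule k Δ φ') (g : M →ₗ⁅ℂ, Sl2⁆ M') :
    ∃ G : (RelaxedVerma k Δ M ⧸ J) →ₗ⁅ℂ, AffineSl2⁆ N',
      ∀ m, G (quotBase (ofBase k Δ M) J m) = φ' (g m) := by
  let G₀ := lift (hφ'.ground.precomp g)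
  -- The radical lies in positive degrees, hence so does its image, and the target has no nonzero
  -- submodule in positive degrees.
  have hJ0 : J.map G₀ = ⊥ := by
    apply hφ'.faithful
    rw [inf_range_eq_bot_iff hφ'.ground hφ'.gen hP']
    rintro _ ⟨w, hw, rfl⟩
    exact map_mem_posPart G₀ ((inf_range_eq_bot_iff isGroundMap_ofBase generates_ofBase hP J).mp
      ((hJ J).mp le_rfl) hw)
  have hker : J.toSubmodule ≤ LinearMap.ker (G₀ : RelaxedVerma k Δ M →ₗ[ℂ] N') := by
    intro w hw
    have : G₀ w ∈ J.map G₀ := LieSubmodule.mem_map_of_mem hw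
    rwa [hJ0] at this
  let G : (RelaxedVerma k Δ M ⧸ J) →ₗ⁅ℂ, AffineSl2⁆ N' :=
    { toLinearMap := J.toSubmodule.liftQ (G₀ : RelaxedVerma k Δ M →ₗ[ℂ] N') hker
      map_lie' := fun {a y} => by
        obtain ⟨w, rfl⟩ := LieSubmodule.Quotient.surjective_mk' J y
        exact G₀.map_lie a w }
  exact ⟨G, fun m => lift_ofBase (hφ'.ground.precomp g) m⟩

variable {N : Type} [AddCommGroup N] [Module ℂ N] [LieRingModule AffineSl2 N]
  [LieModule ℂ AffineSl2 N] {φ : M →ₗ[ℂ] N} {G : N →ₗ⁅ℂ, AffineSl2⁆ N'} {g : M → M'}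

/-- The kernel meets the ground states trivially, and in a top module this makes it zero. -/
theorem injective_of_base (hφ : IsTopModule k Δ φ) (hφ' : Function.Injective φ')
    (hG : ∀ m, G (φ m) = φ' (g m)) (hg : Function.Injective g) : Function.Injective G := by
  rw [← LieModuleHom.ker_eq_bot]
  apply hφ.faithful
  rw [eq_bot_iff]
  rintro _ ⟨hw, m, rfl⟩
  have h0 : φ' (g 0) = 0 := by rw [← hG, map_zero, map_zero]
  have h1 : φ' (g m) = φ' (g 0) := by rw [h0, ← hG]; exact hw
  rw [hg (hφ' h1), map_zero]
  exact Submodule.zero_mem _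

theorem surjective_of_base (hφ' : Generates φ') (hG : ∀ m, G (φ m) = φ' (g m))
    (hg : Function.Surjective g) : Function.Surjective G := by
  rw [← LieModuleHom.range_eq_top]
  refine hφ' _ fun m' => ?_
  obtain ⟨m, rfl⟩ := hg m'
  exact ⟨φ m, hG m⟩

end Functoriality

/-! ## Localisation with respect to nilpotent zero modes -/

section Localisation

variable {L N N' : Type} [LieRing L] [LieAlgebra ℂ L] [AddCommGroup N] [Module ℂ N]
  [LieRingModule L N] [LieModule ℂ L N]

/-- By the Leibniz rule `aⁿ⁺ˢ(x w)` is a combination of terms `((ad a)ⁱ x)(aⁿ⁺ˢ⁻ⁱ w)`: for `i ≥ s`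
the first factor is zero, otherwise the second lies in `P`. The double induction on `s` and `n`
replaces the binomial expansion. -/
theorem pow_lie_mem_of_ad_pow_eq_zero (P : LieSubmodule ℂ L N) {a : L} (s n : ℕ) {x : L} {w : N}
    (hx : (LieAlgebra.ad ℂ L a ^ s) x = 0) (hw : (LieModule.toEnd ℂ L N a ^ n) w ∈ P) :
    (LieModule.toEnd ℂ L N a ^ (n + s)) ⁅x, w⁆ ∈ P := by
  induction s generalizing n x w with
  | zero =>
    have : x = 0 := hx
    rw [this, zero_lie, map_zero]
    exact P.zero_mem
  | succ s ihs =>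
    induction n generalizing w with
    | zero =>
      have hstable (n : ℕ) : ∀ w ∈ P, (LieModule.toEnd ℂ L N a ^ n) w ∈ P := by
        induction n with
        | zero => exact fun w hw => hw
        | succ n ih =>
          intro w hw
          rw [pow_succ, Module.End.mul_apply]
          exact ih _ (P.lie_mem hw)
      exact hstable _ _ (P.lie_mem hw)
    | succ n ihn =>
      rw [show n + 1 + (s + 1) = (n + 1 + s) + 1 by omega, pow_succ, Module.End.mul_apply,
        LieModule.toEnd_apply_apply, leibniz_lie, map_add]
      refine P.add_mem (ihs (n + 1) ?_ hw) ?_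
      · rwa [pow_succ] at hx
      · rw [show n + 1 + s = n + (s + 1) by omega]
        refine ihn ?_
        rwa [pow_succ] at hw

/-- The vectors that are carried into `P` by a power of an element `a` for which `ad a` is
nilpotent. -/
def saturation (P : LieSubmodule ℂ L N) {a : L} {s : ℕ} (ha : LieAlgebra.ad ℂ L a ^ s = 0) :
    LieSubmodule ℂ L N where
  carrier := {w | ∃ n, (LieModule.toEnd ℂ L N a ^ n) w ∈ P}
  zero_mem' := ⟨0, P.zero_mem⟩
  add_mem' := by
    have h1 {n w} (h : (LieModule.toEnd ℂ L N a ^ n) w ∈ P) (m : ℕ) :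
        (LieModule.toEnd ℂ L N a ^ (m + n)) w ∈ P := by
      induction m with
      | zero => rwa [zero_add]
      | succ m ih =>
        rw [show m + 1 + n = (m + n) + 1 by omega, pow_succ', Module.End.mul_apply]
        exact P.lie_mem ih
    rintro w w' ⟨n, hn⟩ ⟨n', hn'⟩
    refine ⟨n + n', ?_⟩
    rw [map_add]
    exact P.add_mem (add_comm n' n ▸ h1 hn n') (h1 hn' n)
  smul_mem' := by
    rintro c w ⟨n, hn⟩
    exact ⟨n, by rw [map_smul]; exact P.smul_mem c hn⟩
  lie_mem := by
    rintro x w ⟨n, hn⟩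
    exact ⟨n + s, pow_lie_mem_of_ad_pow_eq_zero P s n (by rw [ha]; rfl) hn⟩

theorem mem_saturation {P : LieSubmodule ℂ L N} {a : L} {s : ℕ}
    {ha : LieAlgebra.ad ℂ L a ^ s = 0} {w : N} :
    w ∈ saturation P ha ↔ ∃ n, (LieModule.toEnd ℂ L N a ^ n) w ∈ P := Iff.rfl

end Localisation

/-- Bracketing with a zero mode is `ad x` on each coefficient of a loop and annihilates both `K` and
`L₀`. -/
theorem ad_mode_zero_pow (x : Sl2) (hx : ∀ y : Sl2, ⁅x, ⁅x, ⁅x, y⁆⁆⁆ = 0) :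
    LieAlgebra.ad ℂ AffineSl2 (mode 0 x) ^ 3 = 0 := by
  ext1 a
  change ⁅mode 0 x, ⁅mode 0 x, ⁅mode 0 x, a⁆⁆⁆ = 0
  let c : Loop →ₗ[ℂ] AffineSl2 :=
    { toFun := fun l => ⟨l, 0, 0⟩
      map_add' := fun l l' => by ext1 <;> simp
      map_smul' := fun c l => by ext1 <;> simp }
  let T : Submodule ℂ Loop :=
    (LinearMap.ker (LieAlgebra.ad ℂ AffineSl2 (mode 0 x) ^ 3)).comap c
  have hT (l : Loop) : ⁅mode 0 x, ⁅mode 0 x, ⁅mode 0 x, (⟨l, 0, 0⟩ : AffineSl2)⁆⁆⁆ = 0 := by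
    have : l ∈ T := supported_le_of_single (s := Set.univ) (fun n _ y => by
      change ⁅mode 0 x, ⁅mode 0 x, ⁅mode 0 x, mode n y⁆⁆⁆ = 0
      rw [mode_zero_lie_mode, mode_zero_lie_mode, mode_zero_lie_mode, hx]
      ext1 <;> simp [mode]) (by simp)
    exact this
  have hL : ⁅mode 0 x, L0⁆ = 0 := by
    rw [← lie_skew, L0_lie_mode]; simp
  have hK : ⁅mode 0 x, K⁆ = 0 := by
    rw [← lie_skew, K_lie, neg_zero]
  have h : a = ⟨a.loop, 0, 0⟩ + a.cK • K + a.cL • L0 := by ext1 <;> simp [K, L0]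
  rw [h]
  simp only [lie_add, lie_smul, hL, hK, hT, smul_zero, add_zero]

theorem sl2e_lie_lie_lie (y : Sl2) : ⁅sl2e, ⁅sl2e, ⁅sl2e, y⁆⁆⁆ = 0 := by
  have h1 : ⁅sl2e, sl2h⁆ = -((2 : ℂ) • sl2e) := by rw [← lie_skew, sl2h_lie_sl2e]
  rw [sl2_eq y]
  simp only [lie_add, lie_smul, lie_self, lie_neg, h1, sl2e_lie_sl2f, smul_zero, neg_zero,
    add_zero, lie_zero]

theorem sl2f_lie_lie_lie (y : Sl2) : ⁅sl2f, ⁅sl2f, ⁅sl2f, y⁆⁆⁆ = 0 := by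
  have h1 : ⁅sl2f, sl2h⁆ = (2 : ℂ) • sl2f := by rw [← lie_skew, sl2h_lie_sl2f, neg_neg]
  have h2 : ⁅sl2f, sl2e⁆ = -sl2h := by rw [← lie_skew, sl2e_lie_sl2f]
  rw [sl2_eq y]
  simp only [lie_add, lie_smul, lie_self, lie_neg, h1, h2, smul_zero, neg_zero, add_zero]

theorem ad_mode_zero_sl2e : LieAlgebra.ad ℂ AffineSl2 (mode 0 sl2e) ^ 3 = 0 :=
  ad_mode_zero_pow _ sl2e_lie_lie_lie

theorem ad_mode_zero_sl2f : LieAlgebra.ad ℂ AffineSl2 (mode 0 sl2f) ^ 3 = 0 :=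
  ad_mode_zero_pow _ sl2f_lie_lie_lie

/-! ### Zero modes on modules with prescribed ground states -/

section

variable {k Δ lam : ℂ} {M N N' : Type} [AddCommGroup M] [Module ℂ M] [LieRingModule Sl2 M]
  [LieModule ℂ Sl2 M] [AddCommGroup N] [Module ℂ N] [LieRingModule AffineSl2 N]
  [LieModule ℂ AffineSl2 N] [AddCommGroup N'] [Module ℂ N'] [LieRingModule AffineSl2 N']
  [LieModule ℂ AffineSl2 N'] {φ : M →ₗ[ℂ] N}

theorem toEnd_pow_ground (hφ : IsGroundMap k Δ φ) (x : Sl2) (n : ℕ) (m : M) :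
    (LieModule.toEnd ℂ AffineSl2 N (mode 0 x) ^ n) (φ m) =
      φ ((LieModule.toEnd ℂ Sl2 M x ^ n) m) := by
  induction n with
  | zero => rfl
  | succ n ih =>
    rw [pow_succ', pow_succ', Module.End.mul_apply, ih]
    exact hφ.zero_mode x _

/-- A nilpotent element of `sl₂` acts injectively if it acts injectively on the ground states. -/
theorem injective_toEnd_of_ground (hφ : IsTopModule k Δ φ) {x : Sl2}
    (hx : LieAlgebra.ad ℂ AffineSl2 (mode 0 x) ^ 3 = 0)
    (hinj : Function.Injective (LieModule.toEnd ℂ Sl2 M x)) :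
    Function.Injective (LieModule.toEnd ℂ AffineSl2 N (mode 0 x)) := by
  -- The vectors annihilated by some power of `x` form a submodule, and it contains no nonzero
  -- ground state.
  have h : saturation (⊥ : LieSubmodule ℂ AffineSl2 N) hx = ⊥ := by
    apply hφ.faithful
    rw [eq_bot_iff]
    rintro _ ⟨⟨n, hn⟩, m, rfl⟩
    rw [toEnd_pow_ground hφ.ground, LieSubmodule.mem_bot] at hn
    have h1 := (injective_iff_map_eq_zero φ).mp hφ.inj _ hn
    have h2 : Function.Injective (LieModule.toEnd ℂ Sl2 M x ^ n) := by
      rw [Module.End.coe_pow]; exact hinj.iterate n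
    rw [(injective_iff_map_eq_zero _).mp h2 m h1, map_zero]
    exact Submodule.zero_mem _
  rw [injective_iff_map_eq_zero]
  intro w hw
  have h1 : w ∈ saturation (⊥ : LieSubmodule ℂ AffineSl2 N) hx := ⟨1, by rwa [pow_one]⟩
  rwa [h] at h1

/-- If the powers of `x` carry the ground states into a submodule, then they carry everything into
it. -/
theorem exists_pow_mem_of_ground (hφ : IsGroundMap k Δ φ) (hgen : Generates φ) {x : Sl2}
    (hx : LieAlgebra.ad ℂ AffineSl2 (mode 0 x) ^ 3 = 0) (I : LieSubmodule ℂ AffineSl2 N)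
    (h : ∀ m, ∃ n, φ ((LieModule.toEnd ℂ Sl2 M x ^ n) m) ∈ I) (w : N) :
    ∃ n, (LieModule.toEnd ℂ AffineSl2 N (mode 0 x) ^ n) w ∈ I := by
  have h1 : saturation I hx = ⊤ := hgen _ fun m => by
    obtain ⟨n, hn⟩ := h m
    exact ⟨n, by rwa [toEnd_pow_ground hφ]⟩
  exact mem_saturation.mp (h1 ▸ LieSubmodule.mem_top w : w ∈ saturation I hx)

theorem isSl2Triple_mode_zero : IsSl2Triple (mode 0 sl2h) (mode 0 sl2e) (mode 0 sl2f) where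
  h_ne_zero h := by
    have h1 : sl2h = 0 := by
      have := congrArg (fun a : AffineSl2 => a.loop 0) h
      simpa [mode] using this
    have := congrArg (fun x : Sl2 => x.1 0 0) h1
    simp [sl2h] at this
  lie_e_f := by rw [mode_zero_lie_mode, sl2e_lie_sl2f]
  lie_h_e_nsmul := by
    rw [mode_zero_lie_mode, sl2h_lie_sl2e, mode_smul, ← Nat.cast_smul_eq_nsmul ℂ]; norm_num
  lie_h_f_nsmul := by
    rw [mode_zero_lie_mode, sl2h_lie_sl2f, ← Nat.cast_smul_eq_nsmul ℂ, ← neg_smul, mode_smul,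
      ← neg_smul]
    norm_num

/-- A vector of non-integral weight is zero if it is annihilated by `e` and by a power of `f`. -/
theorem eq_zero_of_lie_e_of_pow_f {w : N} {c : ℂ} (hc : ∀ n : ℕ, c ≠ n)
    (hh : ⁅mode 0 sl2h, w⁆ = c • w) (he : ⁅mode 0 sl2e, w⁆ = 0) {n : ℕ}
    (hf : (LieModule.toEnd ℂ AffineSl2 N (mode 0 sl2f) ^ n) w = 0) : w = 0 := by
  by_contra hw
  have hp : isSl2Triple_mode_zero.HasPrimitiveVectorWith w c := ⟨hw, hh, he⟩
  induction n with
  | zero => exact hw hf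
  | succ n ih =>
    -- Here `e fⁿ⁺¹ w = (n + 1)(c - n) fⁿ w`, with nonzero coefficient, so the exponent that
    -- annihilates `w` can be lowered to `0`.
    have h1 := hp.lie_e_pow_succ_toEnd_f n
    rw [hf, lie_zero] at h1
    refine ih ((smul_eq_zero.mp h1.symm).resolve_left (mul_ne_zero ?_ (sub_ne_zero.mpr (hc n))))
    exact Nat.cast_add_one_ne_zero n

end

/-! ## Comparison of weight multiplicities -/

section Comparison

/-- A finite-dimensional space of vectors, each of which is carried into `I` by a power of `T`, is
carried into `I` by all large powers of `T`. -/
theorem exists_forall_pow_mem {V : Type} [AddCommGroup V] [Module ℂ V] {T : Module.End ℂ V}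
    {I : Submodule ℂ V} (hI : ∀ w ∈ I, T w ∈ I) (h : ∀ w, ∃ n, (T ^ n) w ∈ I)
    (W : Submodule ℂ V) [FiniteDimensional ℂ W] : ∃ n₀, ∀ n ≥ n₀, ∀ w ∈ W, (T ^ n) w ∈ I := by
  obtain ⟨s, hs⟩ := (Submodule.fg_iff_finiteDimensional W).mpr inferInstance
  choose N hN using h
  have hmono {w : V} {n : ℕ} (hw : (T ^ n) w ∈ I) (m : ℕ) : (T ^ (n + m)) w ∈ I := by
    induction m with
    | zero => exact hw
    | succ m ih => rw [← add_assoc, pow_succ', Module.End.mul_apply]; exact hI _ ih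
  refine ⟨s.sup N, fun n hn w hw => ?_⟩
  have h1 : W ≤ I.comap (T ^ n) := by
    rw [← hs, Submodule.span_le]
    intro x hx
    obtain ⟨m, rfl⟩ := Nat.exists_eq_add_of_le (le_trans (Finset.le_sup hx) hn)
    exact hmono (hN x) m
  exact h1 hw

variable {Δ lam : ℂ}

variable (Δ lam) in
/-- The module `N` is the sum of finite-dimensional joint eigenspaces of `L₀` and `h`, of
conformal weight `Δ + d` and `sl₂`-weight `lam + 2 j`. -/
structure IsWeightModule (N : Type) [AddCommGroup N] [Module ℂ N] [LieRingModule AffineSl2 N]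
    [LieModule ℂ AffineSl2 N] : Prop where
  fin : ∀ i, FiniteDimensional ℂ (wtSpace Δ lam N i)
  top : ⨆ i, wtSpace Δ lam N i = ⊤
  wt : ∀ {i w}, w ∈ wtSpace Δ lam N i → ⁅mode 0 sl2h, w⁆ = (lam + 2 * i.2) • w

theorem IsTopModule.isWeightModule {k : ℂ} {M N : Type} [AddCommGroup M] [Module ℂ M]
    [LieRingModule Sl2 M] [LieModule ℂ Sl2 M] [AddCommGroup N] [Module ℂ N]
    [LieRingModule AffineSl2 N] [LieModule ℂ AffineSl2 N] {φ : M →ₗ[ℂ] N}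
    {P : ℤ → Submodule ℂ M} (hφ : IsTopModule k Δ φ) (hP : IsWeightDecomp lam P) :
    IsWeightModule Δ lam N where
  fin := finiteDimensional_wtSpace hφ.ground hφ.gen hP
  top := iSup_wtSpace hφ.ground hφ.gen hP
  wt {i w} hw := by
    rw [wtSpace_eq_monomials hφ.ground hφ.gen hP] at hw
    exact sl2h_lie_monomials hφ.ground hP hw

variable {X E Z : Type} [AddCommGroup X] [Module ℂ X] [LieRingModule AffineSl2 X]
  [LieModule ℂ AffineSl2 X] [AddCommGroup E] [Module ℂ E] [LieRingModule AffineSl2 E]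
  [LieModule ℂ AffineSl2 E] [AddCommGroup Z] [Module ℂ Z] [LieRingModule AffineSl2 Z]
  [LieModule ℂ AffineSl2 Z]

theorem pow_mem_wtSpace {i : ℕ × ℤ} {w : E} (hw : w ∈ wtSpace Δ lam E i) (t : Fin 3) (n : ℕ) :
    (LieModule.toEnd ℂ AffineSl2 E (mode 0 (sl2Basis t)) ^ n) w ∈
      wtSpace Δ lam E (i.1, i.2 + n * sl2Shift t) := by
  induction n with
  | zero => simpa using hw
  | succ n ih =>
    rw [pow_succ', Module.End.mul_apply]
    have := wtSpace_shift ih t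
    rwa [show i.2 + n * sl2Shift t + sl2Shift t = i.2 + (n + 1 : ℕ) * sl2Shift t by
      push_cast; ring] at this

/-- The power of the injective operator embeds the weight space of `E` in the image of `X`; as `g`
is injective, the preimages are weight vectors of the shifted weight. -/
theorem finrank_le_of_pow_mem_range {g : X →ₗ⁅ℂ, AffineSl2⁆ E} (hg : Function.Injective g)
    {t : Fin 3}
    (ht : Function.Injective (LieModule.toEnd ℂ AffineSl2 E (mode 0 (sl2Basis t)))) {i : ℕ × ℤ}
    {n : ℕ} (hX : FiniteDimensional ℂ (wtSpace Δ lam X (i.1, i.2 + n * sl2Shift t)))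
    (h : ∀ w ∈ wtSpace Δ lam E i,
      (LieModule.toEnd ℂ AffineSl2 E (mode 0 (sl2Basis t)) ^ n) w ∈ g.range) :
    Module.finrank ℂ (wtSpace Δ lam E i) ≤
      Module.finrank ℂ (wtSpace Δ lam X (i.1, i.2 + n * sl2Shift t)) := by
  have hn : Function.Injective (LieModule.toEnd ℂ AffineSl2 E (mode 0 (sl2Basis t)) ^ n) := by
    rw [Module.End.coe_pow]; exact ht.iterate n
  rw [(Submodule.equivMapOfInjective _ hn (wtSpace Δ lam E i)).finrank_eq,
    (Submodule.equivMapOfInjective (g : X →ₗ[ℂ] E) hg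
      (wtSpace Δ lam X (i.1, i.2 + n * sl2Shift t))).finrank_eq]
  refine Submodule.finrank_mono ?_
  rintro _ ⟨w, hw, rfl⟩
  obtain ⟨x, hx⟩ := h w hw
  refine ⟨x, mem_wtSpace.mpr (hg ?_), hx⟩
  rw [LieModuleHom.map_lie, map_smul, hx]
  exact mem_wtSpace.mp (pow_mem_wtSpace hw t n)

/-- The images of the weight spaces lie in those of `Z` and span `Z`, so they fill them. -/
theorem wtSpace_map_of_surjective {g : E →ₗ⁅ℂ, AffineSl2⁆ Z} (hg : Function.Surjective g)
    (hE : ⨆ i, wtSpace Δ lam E i = ⊤) (i : ℕ × ℤ) :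
    wtSpace Δ lam Z i = (wtSpace Δ lam E i).map (g : E →ₗ[ℂ] Z) := by
  refine wtSpace_eq_of_le (A := fun i => (wtSpace Δ lam E i).map (g : E →ₗ[ℂ] Z))
    (fun i => ?_) ?_ i
  · rintro _ ⟨w, hw, rfl⟩
    exact map_mem_wtSpace g hw
  · rw [← Submodule.map_iSup, hE, Submodule.map_top, LinearMap.range_eq_top]
    exact hg

theorem eq_zero_of_finrank_le {g : E →ₗ⁅ℂ, AffineSl2⁆ Z} (hg : Function.Surjective g)
    (hE : IsWeightModule Δ lam E) {i : ℕ × ℤ}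
    (h : Module.finrank ℂ (wtSpace Δ lam E i) ≤ Module.finrank ℂ (wtSpace Δ lam Z i)) {w : E}
    (hw : w ∈ wtSpace Δ lam E i) (hgw : g w = 0) : w = 0 := by
  have := hE.fin i
  let g₀ : wtSpace Δ lam E i →ₗ[ℂ] Z := (g : E →ₗ[ℂ] Z).domRestrict _
  have h1 := LinearMap.finrank_range_add_finrank_ker g₀
  have h2 : LinearMap.range g₀ = wtSpace Δ lam Z i := by
    rw [wtSpace_map_of_surjective hg hE.top]
    exact LinearMap.range_domRestrict _ _
  rw [h2] at h1
  have h3 : Module.finrank ℂ (LinearMap.ker g₀) = 0 := by omega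
  have h4 : (⟨w, hw⟩ : wtSpace Δ lam E i) ∈ LinearMap.ker g₀ := hgw
  rw [Submodule.finrank_eq_zero.mp h3, Submodule.mem_bot] at h4
  exact congrArg Subtype.val h4

variable {E' : Type} [AddCommGroup E'] [Module ℂ E'] [LieRingModule AffineSl2 E']
  [LieModule ℂ AffineSl2 E']

/-- If `f` acts injectively on `E` and `e` on `E'`, if `X` and `Z` embed in `E` and `E'` with
quotients on which `f` and `e` are locally nilpotent, and if `Z` and `X` are quotients of `E` and
`E'`, then the weight spaces of `E` and `Z` for large weights have the same dimension. -/
theorem exists_finrank_le {ι : X →ₗ⁅ℂ, AffineSl2⁆ E} {ι' : Z →ₗ⁅ℂ, AffineSl2⁆ E'}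
    {π' : E' →ₗ⁅ℂ, AffineSl2⁆ X} (hX : IsWeightModule Δ lam X) (hE : IsWeightModule Δ lam E)
    (hZ : IsWeightModule Δ lam Z) (hE' : IsWeightModule Δ lam E') (hι : Function.Injective ι)
    (hι' : Function.Injective ι') (hπ' : Function.Surjective π')
    (hf : Function.Injective (LieModule.toEnd ℂ AffineSl2 E (mode 0 sl2f)))
    (he : Function.Injective (LieModule.toEnd ℂ AffineSl2 E' (mode 0 sl2e)))
    (hfE : ∀ w, ∃ n, (LieModule.toEnd ℂ AffineSl2 E (mode 0 sl2f) ^ n) w ∈ ι.range)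
    (heE' : ∀ w, ∃ n, (LieModule.toEnd ℂ AffineSl2 E' (mode 0 sl2e) ^ n) w ∈ ι'.range) (d : ℕ) :
    ∃ j₀ : ℤ, ∀ j ≥ j₀, Module.finrank ℂ (wtSpace Δ lam E (d, j)) ≤
      Module.finrank ℂ (wtSpace Δ lam Z (d, j)) := by
  have := hE.fin
  have := hE'.fin
  obtain ⟨J, hJ⟩ : ∃ J, ∀ j, Module.finrank ℂ (wtSpace Δ lam E (d, J)) ≤
      Module.finrank ℂ (wtSpace Δ lam E (d, j)) :=
    ⟨Function.argmin (fun j => Module.finrank ℂ (wtSpace Δ lam E (d, j))),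
      fun j => Function.argmin_le (fun j => Module.finrank ℂ (wtSpace Δ lam E (d, j))) j⟩
  -- Finite dimension provides one exponent for the whole weight space; `f` lowers the weight index
  -- by one, hence the shift `N * -1`.
  obtain ⟨N, hN⟩ := exists_forall_pow_mem (I := ι.range.toSubmodule)
    (fun w hw => LieSubmodule.lie_mem _ hw) hfE (wtSpace Δ lam E (d, J))
  obtain ⟨N', hN'⟩ := exists_forall_pow_mem (I := ι'.range.toSubmodule)
    (fun w hw => LieSubmodule.lie_mem _ hw) heE' (wtSpace Δ lam E' (d, J + N * -1))
  have h1 := finrank_le_of_pow_mem_range (t := 2) hι hf (hX.fin _) (hN N le_rfl)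
  have h2 : Module.finrank ℂ (wtSpace Δ lam X (d, J + N * -1)) ≤
      Module.finrank ℂ (wtSpace Δ lam E' (d, J + N * -1)) := by
    rw [wtSpace_map_of_surjective hπ' hE'.top]
    exact Submodule.finrank_map_le _ _
  -- With `E` itself in place of `X`, injectivity of `f` makes the dimensions decrease as the weight
  -- grows.
  have hanti {j j' : ℤ} (h : j ≤ j') : Module.finrank ℂ (wtSpace Δ lam E (d, j')) ≤
      Module.finrank ℂ (wtSpace Δ lam E (d, j)) := by
    obtain ⟨n, rfl⟩ := Int.exists_add_of_le h
    have h3 := finrank_le_of_pow_mem_range (Δ := Δ) (lam := lam) (g := LieModuleHom.id (M := E))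
      Function.injective_id (t := 2) hf (i := (d, j + n)) (n := n) (hE.fin _)
      (fun w _ => ⟨_, rfl⟩)
    rwa [show (j + n : ℤ) + n * sl2Shift 2 = j by simp [sl2Shift]] at h3
  -- From weight `J - N` the power `N' + n` of `e` reaches `J - N + N' + n`, so this covers every `j
  -- ≥ J - N + N'`; the condition `j ≥ J` allows the comparison with `E` at `J`.
  refine ⟨max J (J - N + N'), fun j hj => ?_⟩
  obtain ⟨n, rfl⟩ := Int.exists_add_of_le (le_trans (le_max_right _ _) hj)
  have h4 := finrank_le_of_pow_mem_range (t := 0) hι' he (hZ.fin _) (hN' (N' + n) (by omega))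
  rw [show (J + N * -1 : ℤ) + (N' + n : ℕ) * sl2Shift 0 = J - N + N' + n by
    simp [sl2Shift]; ring] at h4
  exact (hanti (le_trans (le_max_left _ _) hj)).trans (h1.trans (h2.trans h4))

/-- Modulo the submodule `X`, the element `e` acts injectively. -/
theorem mem_range_of_lie_mem {ι : X →ₗ⁅ℂ, AffineSl2⁆ E} (hlam : ∀ n : ℤ, lam ≠ n)
    (hE : IsWeightModule Δ lam E)
    (hfE : ∀ w, ∃ n, (LieModule.toEnd ℂ AffineSl2 E (mode 0 sl2f) ^ n) w ∈ ι.range)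
    {i : ℕ × ℤ} {w : E} (hw : w ∈ wtSpace Δ lam E i) (hew : ⁅mode 0 sl2e, w⁆ ∈ ι.range) :
    w ∈ ι.range := by
  -- In the quotient the class of `w` has nonintegral weight and is annihilated by `e` and by a
  -- power of `f`.
  let p := LieSubmodule.Quotient.mk' ι.range
  obtain ⟨n, hn⟩ := hfE w
  have hp (w : E) (n : ℕ) : p ((LieModule.toEnd ℂ AffineSl2 E (mode 0 sl2f) ^ n) w) =
      (LieModule.toEnd ℂ AffineSl2 (E ⧸ ι.range) (mode 0 sl2f) ^ n) (p w) := by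
    induction n with
    | zero => rfl
    | succ n ih =>
      rw [pow_succ', pow_succ', Module.End.mul_apply, Module.End.mul_apply, ← ih]
      exact p.map_lie _ _
  refine (LieSubmodule.Quotient.mk_eq_zero (N := ι.range)).mp
    (eq_zero_of_lie_e_of_pow_f (w := p w) (c := lam + 2 * i.2) ?_ ?_ ?_ (n := n) ?_)
  · intro m hm
    apply hlam (m - 2 * i.2)
    push_cast
    linear_combination hm
  · rw [← LieModuleHom.map_lie, hE.wt hw, map_smul]
  · rw [← LieModuleHom.map_lie]
    exact (LieSubmodule.Quotient.mk_eq_zero (N := ι.range)).mpr hew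
  · rw [← hp]
    exact (LieSubmodule.Quotient.mk_eq_zero (N := ι.range)).mpr hn

theorem ker_le_range {ι : X →ₗ⁅ℂ, AffineSl2⁆ E} {π : E →ₗ⁅ℂ, AffineSl2⁆ Z}
    {ι' : Z →ₗ⁅ℂ, AffineSl2⁆ E'} {π' : E' →ₗ⁅ℂ, AffineSl2⁆ X} (hlam : ∀ n : ℤ, lam ≠ n)
    (hX : IsWeightModule Δ lam X) (hE : IsWeightModule Δ lam E) (hZ : IsWeightModule Δ lam Z)
    (hE' : IsWeightModule Δ lam E') (hι : Function.Injective ι) (hπ : Function.Surjective π)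
    (hι' : Function.Injective ι') (hπ' : Function.Surjective π')
    (hf : Function.Injective (LieModule.toEnd ℂ AffineSl2 E (mode 0 sl2f)))
    (he : Function.Injective (LieModule.toEnd ℂ AffineSl2 E' (mode 0 sl2e)))
    (hfE : ∀ w, ∃ n, (LieModule.toEnd ℂ AffineSl2 E (mode 0 sl2f) ^ n) w ∈ ι.range)
    (heE' : ∀ w, ∃ n, (LieModule.toEnd ℂ AffineSl2 E' (mode 0 sl2e) ^ n) w ∈ ι'.range) {w : E}
    (hw : π w = 0) : w ∈ ι.range := by
  -- Induction on the distance below the threshold `j₀`: from `j₀` upwards `π` is injective, and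
  -- below it `e w` is in the kernel of `π` one step higher.
  have key (d : ℕ) (j₀ : ℤ) (hj₀ : ∀ j ≥ j₀, Module.finrank ℂ (wtSpace Δ lam E (d, j)) ≤
      Module.finrank ℂ (wtSpace Δ lam Z (d, j))) (n : ℕ) : ∀ (j : ℤ) (w : E),
      j₀ - j ≤ n → w ∈ wtSpace Δ lam E (d, j) → π w = 0 → w ∈ ι.range := by
    induction n with
    | zero =>
      intro j w hj h1 h2
      rw [eq_zero_of_finrank_le hπ hE (hj₀ j (by push_cast at hj; omega)) h1 h2]
      exact ι.range.zero_mem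
    | succ n ih =>
      intro j w hj h1 h2
      refine mem_range_of_lie_mem hlam hE hfE h1 (ih (j + 1) _ ?_ (wtSpace_shift h1 0) ?_)
      · push_cast at hj; omega
      · rw [LieModuleHom.map_lie, h2, lie_zero]
  obtain ⟨v, hv, rfl⟩ := exists_weight_components hE.top π hw
  refine Submodule.sum_mem ι.range.toSubmodule fun i _ => ?_
  obtain ⟨j₀, hj₀⟩ := exists_finrank_le hX hE hZ hE' hι hι' hπ' hf he hfE heE' i.1
  exact key i.1 j₀ hj₀ (j₀ - i.2).toNat i.2 _ (Int.self_le_toNat _) (hv i).1 (hv i).2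

end Comparison

/-! ## The modules of ground states -/

section Base

/-- The linear map `v_n ↦ c n v_{σ n}` between spaces with bases `v_n`. -/
def reindex {I I' : Type} (σ : I → I') (c : I → ℂ) : (I →₀ ℂ) →ₗ[ℂ] (I' →₀ ℂ) :=
  Finsupp.lsum ℂ fun n => c n • Finsupp.lsingle (σ n)

theorem reindex_single {I I' : Type} (σ : I → I') (c : I → ℂ) (n : I) (t : ℂ) :
    reindex σ c (Finsupp.single n t) = Finsupp.single (σ n) (c n * t) := by
  simp [reindex]

theorem reindex_injective {I I' : Type} {σ : I → I'} {c : I → ℂ} (hσ : Function.Injective σ)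
    (hc : ∀ n, c n ≠ 0) : Function.Injective (reindex σ c) := by
  have h (v : I →₀ ℂ) (n : I) : reindex σ c v (σ n) = c n * v n := by
    induction v using Finsupp.induction_linear with
    | zero => simp
    | add v v' h h' => rw [map_add, Finsupp.add_apply, h, h', Finsupp.add_apply, mul_add]
    | single m t =>
      classical
      rw [reindex_single, Finsupp.single_apply, Finsupp.single_apply, hσ.eq_iff]
      split_ifs with h
      · rw [h]
      · rw [mul_zero]
  intro v v' hv
  ext n
  have := DFunLike.congr_fun hv (σ n)
  rw [h, h] at this
  exact mul_left_cancel₀ (hc n) this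

theorem reindex_surjective {I I' : Type} {σ : I → I'} {c : I → ℂ}
    (h : ∀ n, ∃ m, σ m = n ∧ c m ≠ 0) : Function.Surjective (reindex σ c) := by
  intro v
  induction v using Finsupp.induction_linear with
  | zero => exact ⟨0, map_zero _⟩
  | add v v' h h' =>
    obtain ⟨x, rfl⟩ := h
    obtain ⟨x', rfl⟩ := h'
    exact ⟨x + x', map_add _ _ _⟩
  | single n t =>
    obtain ⟨m, rfl, hm⟩ := h n
    exact ⟨Finsupp.single m ((c m)⁻¹ * t), by rw [reindex_single, mul_inv_cancel_left₀ hm]⟩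

namespace Sl2Rep

variable {V V' : Type} [AddCommGroup V] [Module ℂ V] [AddCommGroup V'] [Module ℂ V']
  (T : Sl2Rep V) (T' : Sl2Rep V')

theorem act_sl2e : T.act sl2e = T.E := by simp [act, sl2e]

theorem act_sl2h : T.act sl2h = T.H := by simp [act, sl2h]

theorem act_sl2f : T.act sl2f = T.F := by simp [act, sl2f]

variable {T T'}

/-- A linear map that commutes with `e`, `h` and `f` is a homomorphism of `sl₂`-modules. -/
def hom (g : V →ₗ[ℂ] V') (hE : ∀ v, g (T.E v) = T'.E (g v)) (hH : ∀ v, g (T.H v) = T'.H (g v))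
    (hF : ∀ v, g (T.F v) = T'.F (g v)) : T.Mod →ₗ⁅ℂ, Sl2⁆ T'.Mod where
  toLinearMap := T'.toMod.toLinearMap ∘ₗ g ∘ₗ T.toMod.symm.toLinearMap
  map_lie' {x v} := by
    have h (v : V) : g (T.act x v) = T'.act x (g v) := by simp [act, hE, hH, hF]
    exact h v

/-- A linear map that commutes with `e`, `h` and `f` on basis vectors is a homomorphism of
`sl₂`-modules. -/
def homOfBasis {I : Type} {T : Sl2Rep (I →₀ ℂ)} (g : (I →₀ ℂ) →ₗ[ℂ] V')
    (hE : ∀ n t, g (T.E (Finsupp.single n t)) = T'.E (g (Finsupp.single n t)))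
    (hH : ∀ n t, g (T.H (Finsupp.single n t)) = T'.H (g (Finsupp.single n t)))
    (hF : ∀ n t, g (T.F (Finsupp.single n t)) = T'.F (g (Finsupp.single n t))) :
    T.Mod →ₗ⁅ℂ, Sl2⁆ T'.Mod :=
  hom g (DFunLike.congr_fun (Finsupp.lhom_ext (φ := g ∘ₗ T.E) (ψ := T'.E ∘ₗ g) hE))
    (DFunLike.congr_fun (Finsupp.lhom_ext (φ := g ∘ₗ T.H) (ψ := T'.H ∘ₗ g) hH))
    (DFunLike.congr_fun (Finsupp.lhom_ext (φ := g ∘ₗ T.F) (ψ := T'.F ∘ₗ g) hF))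

end Sl2Rep

/-- Distinct basis vectors have distinct weights, so each weight space is at most a line. -/
theorem isWeightDecomp_of_basis {I : Type} (T : Sl2Rep (I →₀ ℂ)) {w : I → ℤ}
    (hw : Function.Injective w) {lam : ℂ}
    (h : ∀ n t, T.H (Finsupp.single n t) = (lam + 2 * w n) • Finsupp.single n t) :
    IsWeightDecomp (M := T.Mod) lam fun j =>
      (Submodule.span ℂ ((fun n => Finsupp.single n 1) '' {n | w n = j})).map
        T.toMod.toLinearMap where
  fin j := by
    have : {n | w n = j}.Subsingleton := fun n hn n' hn' => hw (hn.trans hn'.symm)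
    have := FiniteDimensional.span_of_finite ℂ
      (this.finite.image fun n => (Finsupp.single n 1 : I →₀ ℂ))
    infer_instance
  wt {j m} hm := by
    obtain ⟨m, hm, rfl⟩ := hm
    change T.act sl2h m = (lam + 2 * j) • m
    rw [Sl2Rep.act_sl2h]
    induction hm using Submodule.span_induction with
    | mem m hm =>
      obtain ⟨n, hn, rfl⟩ := hm
      obtain rfl : w n = j := hn
      exact h n 1
    | zero => simp
    | add m m' _ _ h h' => rw [map_add, h, h', smul_add]
    | smul c m _ h => rw [map_smul, h, smul_comm]
  top := by
    rw [eq_top_iff]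
    intro m _
    suffices h : ∀ m : I →₀ ℂ, T.toMod m ∈ ⨆ j, (Submodule.span ℂ
        ((fun n => (Finsupp.single n 1 : I →₀ ℂ)) '' {n | w n = j})).map T.toMod.toLinearMap from
      h m
    intro m
    induction m using Finsupp.induction_linear with
    | zero => rw [map_zero]; exact Submodule.zero_mem _
    | add m m' h h' => rw [map_add]; exact Submodule.add_mem _ h h'
    | single n t =>
      refine Submodule.mem_iSup_of_mem (w n) ⟨Finsupp.single n t, ?_, rfl⟩
      rw [← mul_one t, ← smul_eq_mul, ← Finsupp.smul_single]
      exact Submodule.smul_mem _ _ (Submodule.subset_span ⟨n, rfl, rfl⟩)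

/-! ### Simplicity of Verma modules of nonintegral weight -/

section Simple

variable {a b : ℕ → ℂ}

theorem shiftEnd_pred_apply (hb : b 0 = 0) (v : ℕ →₀ ℂ) (n : ℕ) :
    shiftEnd (fun n => n - 1) b v n = b (n + 1) * v (n + 1) := by
  induction v using Finsupp.induction_linear with
  | zero => simp
  | add v v' h h' => rw [map_add, Finsupp.add_apply, h, h', Finsupp.add_apply, mul_add]
  | single m t =>
    rw [shiftEnd_single]
    rcases m with _ | m
    · simp [hb]
    · rw [Nat.add_sub_cancel, Finsupp.single_apply, Finsupp.single_apply]
      by_cases h : m = n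
      · simp [h]
      · simp [h]

/-- A space with basis `v_n`, `n ∈ ℕ`, has no proper subspace that is stable under the raising
operator and under a lowering operator that annihilates only `v_0`. -/
theorem eq_bot_or_eq_top_of_stable (hb : b 0 = 0) (hb' : ∀ n, b (n + 1) ≠ 0)
    (S : Submodule ℂ (ℕ →₀ ℂ)) (hlow : ∀ v ∈ S, shiftEnd (fun n => n - 1) b v ∈ S)
    (hup : ∀ v ∈ S, shiftEnd (fun n => n + 1) (fun _ => 1) v ∈ S) : S = ⊥ ∨ S = ⊤ := by
  rw [or_iff_not_imp_left]
  intro hS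
  obtain ⟨v, hv, hv0⟩ := Submodule.exists_mem_ne_zero_of_ne_bot hS
  -- Lowering moves the top coefficient from index `N + 1` to `N` and keeps it nonzero; repeating
  -- this ends in a nonzero multiple of `v_0`.
  have key (N : ℕ) : ∀ v ∈ S, v ≠ 0 → (∀ n > N, v n = 0) → Finsupp.single 0 1 ∈ S := by
    induction N with
    | zero =>
      intro v hv hv0 hN
      have h : v = Finsupp.single 0 (v 0) := by
        ext n
        rcases n with _ | n
        · simp
        · rw [hN _ (Nat.succ_pos n)]; simp
      have h0 : v 0 ≠ 0 := fun h0 => hv0 (by rw [h, h0, Finsupp.single_zero])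
      have h1 := S.smul_mem (v 0)⁻¹ hv
      rwa [h, Finsupp.smul_single, Finsupp.single_eq_same, smul_eq_mul,
        inv_mul_cancel₀ h0] at h1
    | succ N ih =>
      intro v hv hv0 hN
      by_cases hvN : v (N + 1) = 0
      · refine ih v hv hv0 fun n hn => ?_
        rcases Nat.lt_or_ge (N + 1) n with h | h
        · exact hN n h
        · rwa [show n = N + 1 by omega]
      · refine ih _ (hlow v hv) (fun h => ?_) fun n hn => ?_
        · have h1 := DFunLike.congr_fun h N
          rw [shiftEnd_pred_apply hb] at h1
          exact mul_ne_zero (hb' N) hvN h1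
        · rw [shiftEnd_pred_apply hb, hN (n + 1) (by omega), mul_zero]
  have h0 : Finsupp.single 0 1 ∈ S := key (v.support.sup id) v hv hv0 fun n hn => by
    by_contra h
    exact absurd (Finset.le_sup (f := id) (Finsupp.mem_support_iff.mpr h)) (not_le.mpr hn)
  have hall (n : ℕ) : Finsupp.single n 1 ∈ S := by
    induction n with
    | zero => exact h0
    | succ n ih =>
      have := hup _ ih
      rwa [shiftEnd_single, one_mul] at this
  rw [eq_top_iff]
  intro v _
  rw [← Finsupp.sum_single v]
  refine S.sum_mem fun n _ => ?_
  have := S.smul_mem (v n) (hall n)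
  rwa [Finsupp.smul_single, smul_eq_mul, mul_one] at this

theorem VermaPlus.eq_bot_or_eq_top {μ : ℂ} (hμ : ∀ n : ℤ, μ ≠ n)
    (S : LieSubmodule ℂ Sl2 (VermaPlus μ)) : S = ⊥ ∨ S = ⊤ := by
  have h (x : Sl2) (v : ℕ →₀ ℂ) (hv : v ∈ S.toSubmodule) :
      (vermaPlusRep μ).act x v ∈ S.toSubmodule := S.lie_mem (x := x) hv
  have hb (n : ℕ) : ((n + 1 : ℕ) : ℂ) * (μ - (n + 1 : ℕ) + 1) ≠ 0 := fun h => by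
    rcases mul_eq_zero.mp h with h | h
    · exact Nat.cast_ne_zero.mpr n.succ_ne_zero h
    · exact hμ n (by push_cast at h ⊢; linear_combination h)
  rcases eq_bot_or_eq_top_of_stable (b := fun n => n * (μ - n + 1)) (by simp) hb S.toSubmodule
    (fun v hv => by have := h sl2e v hv; rwa [Sl2Rep.act_sl2e] at this)
    (fun v hv => by have := h sl2f v hv; rwa [Sl2Rep.act_sl2f] at this) with h | h
  · exact Or.inl ((LieSubmodule.toSubmodule_eq_bot S).mp h)
  · exact Or.inr ((LieSubmodule.toSubmodule_eq_top (N := S)).mp h)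

theorem VermaMinus.eq_bot_or_eq_top {μ : ℂ} (hμ : ∀ n : ℤ, μ ≠ n)
    (S : LieSubmodule ℂ Sl2 (VermaMinus μ)) : S = ⊥ ∨ S = ⊤ := by
  have h (x : Sl2) (v : ℕ →₀ ℂ) (hv : v ∈ S.toSubmodule) :
      (vermaMinusRep μ).act x v ∈ S.toSubmodule := S.lie_mem (x := x) hv
  have hb (n : ℕ) : -((n + 1 : ℕ) : ℂ) * (μ + (n + 1 : ℕ) - 1) ≠ 0 := fun h => by
    rcases mul_eq_zero.mp h with h | h
    · exact Nat.cast_ne_zero.mpr n.succ_ne_zero (neg_eq_zero.mp h)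
    · exact hμ (-n) (by push_cast at h ⊢; linear_combination h)
  rcases eq_bot_or_eq_top_of_stable (b := fun n => -n * (μ + n - 1)) (by simp) hb S.toSubmodule
    (fun v hv => by have := h sl2f v hv; rwa [Sl2Rep.act_sl2f] at this)
    (fun v hv => by have := h sl2e v hv; rwa [Sl2Rep.act_sl2e] at this) with h | h
  · exact Or.inl ((LieSubmodule.toSubmodule_eq_bot S).mp h)
  · exact Or.inr ((LieSubmodule.toSubmodule_eq_top (N := S)).mp h)

end Simple

/-! ### The two opposite extensions of the Verma modules -/

section Maps

variable {μ : ℂ}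

/-- The raising coefficients of `linkedRep`. -/
def linkedUp (μ : ℂ) (j : ℤ) : ℂ := if j < 0 then -j * (μ + j + 1) else 1

/-- The lowering coefficients of `linkedRep`. -/
def linkedDown (μ : ℂ) (j : ℤ) : ℂ := if j ≤ 0 then 1 else -(j - 1) * (μ + j)

/-- The dense module, with basis `v_j`, in which the Verma module of lowest weight `μ + 2` is a
submodule and the Verma module of highest weight `μ` is the quotient; `e` acts injectively if `μ`
is not an integer. -/
def linkedRep (μ : ℂ) : Sl2Rep (ℤ →₀ ℂ) where
  E := shiftEnd (fun j => j + 1) (linkedUp μ)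
  H := shiftEnd (fun j => j) fun j => μ + 2 * j
  F := shiftEnd (fun j => j - 1) (linkedDown μ)
  hHE := by
    refine Finsupp.lhom_ext fun n t => ?_
    simp only [LinearMap.sub_apply, Module.End.mul_apply, LinearMap.smul_apply, shiftEnd_single,
      ← Finsupp.single_sub, Finsupp.smul_single, smul_eq_mul]
    congr 1
    push_cast; ring
  hEF := by
    refine Finsupp.lhom_ext fun n t => ?_
    simp only [LinearMap.sub_apply, Module.End.mul_apply, shiftEnd_single,
      sub_add_cancel, add_sub_cancel_right, ← Finsupp.single_sub]
    congr 1
    simp only [linkedUp, linkedDown]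
    rcases lt_trichotomy n 0 with h | rfl | h
    · rw [if_pos (by omega), if_pos (by omega), if_pos (by omega), if_pos (by omega)]
      push_cast; ring
    · simp
    · rcases (show n = 1 ∨ 1 < n by omega) with rfl | h
      · simp; ring
      · rw [if_neg (by omega), if_neg (by omega), if_neg (by omega), if_neg (by omega)]
        push_cast; ring
  hHF := by
    refine Finsupp.lhom_ext fun n t => ?_
    simp only [LinearMap.sub_apply, Module.End.mul_apply, LinearMap.smul_apply,
      LinearMap.neg_apply, shiftEnd_single,
      ← Finsupp.single_sub, ← Finsupp.single_neg, Finsupp.smul_single, smul_eq_mul]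
    congr 1
    push_cast; ring

/-- The factorisation shows where the dense module breaks: at `c = 0`, and for nonintegral `μ` at no
other integer. -/
theorem gamma_of_casimir {q : ℂ} (hq : q = μ * (μ + 2) / 2) (c : ℂ) :
    gamma q (μ + 2 * c) = -c * (μ + c + 1) := by
  simp only [gamma, bilin, hq]; ring

/-- The inclusion of the Verma module of highest weight `μ` in a dense module. -/
def vermaPlusToDense {q : ℂ} (hq : q = μ * (μ + 2) / 2) :
    VermaPlus μ →ₗ⁅ℂ, Sl2⁆ Dense μ q :=
  Sl2Rep.homOfBasis (reindex (fun n : ℕ => -(n : ℤ)) fun _ => 1)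
    (fun n t => by
      simp only [vermaPlusRep, denseRep, shiftEnd_single, reindex_single]
      rw [gamma_of_casimir hq]
      rcases n with _ | n
      · simp
      · congr 1
        · push_cast; ring
        · push_cast; ring)
    (fun n t => by
      simp only [vermaPlusRep, denseRep, shiftEnd_single, reindex_single,
        bilin]
      congr 1
      push_cast; ring)
    (fun n t => by
      simp only [vermaPlusRep, denseRep, shiftEnd_single, reindex_single]
      congr 1
      push_cast; ring)

/-- The scaling of the basis vectors under the projection from a dense module to the Verma module
of lowest weight `μ + 2`. -/
def denseScale (μ : ℂ) (n : ℕ) : ℂ := ∏ i ∈ Finset.range n, (-(i + 1) * (μ + i + 2))⁻¹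

theorem denseScale_ne_zero (hμ : ∀ n : ℤ, μ ≠ n) (n : ℕ) : denseScale μ n ≠ 0 := by
  refine Finset.prod_ne_zero_iff.mpr fun i _ => inv_ne_zero (mul_ne_zero ?_ fun h => ?_)
  · exact neg_ne_zero.mpr (Nat.cast_add_one_ne_zero i)
  · exact hμ (-(i + 2)) (by push_cast; linear_combination h)

/-- This is the recursion demanded by compatibility with `e`, whose coefficient is `-(n + 1)(μ + n +
2)` at index `n + 1` of the dense module and `1` in the Verma module. -/
theorem denseScale_succ (hμ : ∀ n : ℤ, μ ≠ n) (n : ℕ) :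
    denseScale μ (n + 1) * (-(n + 1) * (μ + n + 2)) = denseScale μ n := by
  rw [denseScale, Finset.prod_range_succ, mul_assoc, inv_mul_cancel₀, mul_one, denseScale]
  refine mul_ne_zero (neg_ne_zero.mpr (Nat.cast_add_one_ne_zero n)) fun h => ?_
  exact hμ (-(n + 2)) (by push_cast; linear_combination h)

/-- The projection of a dense module to the Verma module of lowest weight `μ + 2`. -/
def denseToVermaMinus (hμ : ∀ n : ℤ, μ ≠ n) {q : ℂ} (hq : q = μ * (μ + 2) / 2) :
    Dense μ q →ₗ⁅ℂ, Sl2⁆ VermaMinus (μ + 2) :=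
  -- Index `1` carries the lowest weight `μ + 2`. For `j ≤ 0` the truncation `toNat` returns `0`,
  -- which is harmless because the coefficient there is zero.
  Sl2Rep.homOfBasis (reindex (fun j : ℤ => (j - 1).toNat)
      fun j => if 1 ≤ j then denseScale μ (j - 1).toNat else 0)
    (fun j t => by
      simp only [vermaMinusRep, denseRep, shiftEnd_single, reindex_single]
      rw [gamma_of_casimir hq]
      rcases lt_trichotomy j 0 with h | rfl | h
      · simp [show ¬ 1 ≤ j by omega, show ¬ 1 ≤ j + 1 by omega]
      · simp
      · obtain ⟨n, rfl⟩ : ∃ n : ℕ, j = n + 1 := ⟨(j - 1).toNat, by omega⟩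
        rw [if_pos (by omega), if_pos (by omega),
          show ((n : ℤ) + 1 + 1 - 1).toNat = n + 1 by omega,
          show ((n : ℤ) + 1 - 1).toNat = n by omega, ← denseScale_succ hμ n]
        congr 1
        push_cast; ring)
    (fun j t => by
      simp only [vermaMinusRep, denseRep, shiftEnd_single, reindex_single,
        bilin]
      split_ifs with h
      · obtain ⟨n, rfl⟩ : ∃ n : ℕ, j = n + 1 := ⟨(j - 1).toNat, by omega⟩
        rw [show ((n : ℤ) + 1 - 1).toNat = n by omega]
        congr 1
        push_cast; ring
      · simp)
    (fun j t => by
      simp only [vermaMinusRep, denseRep, shiftEnd_single, reindex_single]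
      rcases lt_trichotomy j 1 with h | rfl | h
      · simp [show ¬ 1 ≤ j by omega, show ¬ 1 ≤ j - 1 by omega]
      · simp
      · obtain ⟨n, rfl⟩ : ∃ n : ℕ, j = n + 2 := ⟨(j - 2).toNat, by omega⟩
        rw [if_pos (by omega), if_pos (by omega),
          show ((n : ℤ) + 2 - 1).toNat = n + 1 by omega,
          show ((n : ℤ) + 2 - 1 - 1).toNat = n by omega, ← denseScale_succ hμ n]
        congr 1
        push_cast; ring)

/-- The inclusion of the Verma module of lowest weight `μ + 2` in `linkedRep μ`. -/
def vermaMinusToLinked (μ : ℂ) : VermaMinus (μ + 2) →ₗ⁅ℂ, Sl2⁆ (linkedRep μ).Mod :=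
  Sl2Rep.homOfBasis (reindex (fun n : ℕ => (n : ℤ) + 1) fun _ => 1)
    (fun n t => by
      simp only [vermaMinusRep, linkedRep, shiftEnd_single, reindex_single,
        linkedUp]
      rw [if_neg (by omega)]
      push_cast; rfl)
    (fun n t => by
      simp only [vermaMinusRep, linkedRep, shiftEnd_single, reindex_single]
      congr 1
      push_cast; ring)
    (fun n t => by
      simp only [vermaMinusRep, linkedRep, shiftEnd_single, reindex_single,
        linkedDown]
      rw [if_neg (by omega)]
      rcases n with _ | n
      · simp
      · congr 1
        · push_cast; omega
        · push_cast; ring)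

/-- The projection of `linkedRep μ` to the Verma module of highest weight `μ`. -/
def linkedToVermaPlus (μ : ℂ) : (linkedRep μ).Mod →ₗ⁅ℂ, Sl2⁆ VermaPlus μ :=
  Sl2Rep.homOfBasis (reindex (fun j : ℤ => (-j).toNat) fun j => if j ≤ 0 then 1 else 0)
    (fun j t => by
      simp only [vermaPlusRep, linkedRep, shiftEnd_single, reindex_single,
        linkedUp]
      rcases lt_trichotomy j 0 with h | rfl | h
      · obtain ⟨n, rfl⟩ : ∃ n : ℕ, j = -(n + 1) := ⟨(-j - 1).toNat, by omega⟩
        rw [if_pos (by omega), if_pos (by omega), if_pos (by omega),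
          show (-(-((n : ℤ) + 1) + 1)).toNat = n by omega,
          show (-(-((n : ℤ) + 1))).toNat = n + 1 by omega, Nat.add_sub_cancel]
        congr 1
        push_cast; ring
      · simp
      · simp [show ¬ j ≤ 0 by omega, show ¬ j + 1 ≤ 0 by omega])
    (fun j t => by
      simp only [vermaPlusRep, linkedRep, shiftEnd_single, reindex_single]
      split_ifs with h
      · obtain ⟨n, rfl⟩ : ∃ n : ℕ, j = -n := ⟨(-j).toNat, by omega⟩
        rw [show (-(-(n : ℤ))).toNat = n by omega]
        congr 1
        push_cast; ring
      · simp)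
    (fun j t => by
      simp only [vermaPlusRep, linkedRep, shiftEnd_single, reindex_single,
        linkedDown]
      rcases lt_trichotomy j 1 with h | rfl | h
      · rw [if_pos (by omega), if_pos (by omega), if_pos (by omega),
          show (-(j - 1)).toNat = (-j).toNat + 1 by omega]
      · simp
      · simp [show ¬ j ≤ 0 by omega, show ¬ j - 1 ≤ 0 by omega])

end Maps

end Base

/-! ## The exact sequence -/

section Main

variable {μ : ℂ}

theorem isWeightDecomp_vermaPlus (μ : ℂ) : ∃ P, IsWeightDecomp (M := VermaPlus μ) μ P :=
  ⟨_, isWeightDecomp_of_basis (vermaPlusRep μ) (w := fun n : ℕ => -(n : ℤ))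
    (neg_injective.comp Nat.cast_injective) fun n t => by
      simp only [vermaPlusRep, shiftEnd_single, Finsupp.smul_single, smul_eq_mul]
      congr 1
      push_cast; ring⟩

/-- Weights are counted from `μ` rather than from the lowest weight `μ + 2`, so that all four
modules share one index set; hence the shift `n + 1`. -/
theorem isWeightDecomp_vermaMinus (μ : ℂ) : ∃ P, IsWeightDecomp (M := VermaMinus (μ + 2)) μ P :=
  ⟨_, isWeightDecomp_of_basis (vermaMinusRep (μ + 2)) (w := fun n : ℕ => (n : ℤ) + 1)
    ((add_left_injective 1).comp Nat.cast_injective) fun n t => by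
      simp only [vermaMinusRep, shiftEnd_single, Finsupp.smul_single, smul_eq_mul]
      congr 1
      push_cast; ring⟩

theorem isWeightDecomp_dense (μ q : ℂ) : ∃ P, IsWeightDecomp (M := Dense μ q) μ P :=
  ⟨_, isWeightDecomp_of_basis (denseRep μ q) (w := id) Function.injective_id fun n t => by
      simp only [denseRep, shiftEnd_single, Finsupp.smul_single, smul_eq_mul, bilin, id]
      congr 1
      ring⟩

theorem isWeightDecomp_linked (μ : ℂ) : ∃ P, IsWeightDecomp (M := (linkedRep μ).Mod) μ P :=
  ⟨_, isWeightDecomp_of_basis (linkedRep μ) (w := id) Function.injective_id fun n t => by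
      simp only [linkedRep, shiftEnd_single, Finsupp.smul_single, smul_eq_mul, id]⟩

instance {I : Type} [Nonempty I] (T : Sl2Rep (I →₀ ℂ)) : Nontrivial T.Mod :=
  inferInstanceAs (Nontrivial (I →₀ ℂ))

theorem ad_sl2e : LieAlgebra.ad ℂ Sl2 sl2e ^ 3 = 0 := LinearMap.ext sl2e_lie_lie_lie

theorem ad_sl2f : LieAlgebra.ad ℂ Sl2 sl2f ^ 3 = 0 := LinearMap.ext sl2f_lie_lie_lie

theorem eq_top_of_single_mem {I : Type} (T : Sl2Rep (I →₀ ℂ)) (S : LieSubmodule ℂ Sl2 T.Mod)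
    (h : ∀ n t, T.toMod (Finsupp.single n t) ∈ S) : S = ⊤ := by
  rw [eq_top_iff]
  intro v _
  suffices h : ∀ v : I →₀ ℂ, T.toMod v ∈ S from h v
  intro v
  induction v using Finsupp.induction_linear with
  | zero => rw [map_zero]; exact S.zero_mem
  | add v v' h h' => rw [map_add]; exact S.add_mem h h'
  | single n t => exact h n t

theorem toEnd_toMod_pow {V : Type} [AddCommGroup V] [Module ℂ V] (T : Sl2Rep V) (x : Sl2) (n : ℕ)
    (v : V) : (LieModule.toEnd ℂ Sl2 T.Mod x ^ n) (T.toMod v) = T.toMod ((T.act x ^ n) v) := by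
  induction n with
  | zero => rfl
  | succ n ih => rw [pow_succ', pow_succ', Module.End.mul_apply, ih]; rfl

theorem vermaPlusToDense_injective {q : ℂ} (hq : q = μ * (μ + 2) / 2) :
    Function.Injective (vermaPlusToDense hq) :=
  reindex_injective (neg_injective.comp Nat.cast_injective) fun _ => one_ne_zero

theorem denseToVermaMinus_surjective (hμ : ∀ n : ℤ, μ ≠ n) {q : ℂ} (hq : q = μ * (μ + 2) / 2) :
    Function.Surjective (denseToVermaMinus hμ hq) :=
  reindex_surjective fun n => ⟨n + 1, by omega, by
    rw [if_pos (by omega)]; exact denseScale_ne_zero hμ _⟩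

theorem denseToVermaMinus_vermaPlusToDense (hμ : ∀ n : ℤ, μ ≠ n) {q : ℂ}
    (hq : q = μ * (μ + 2) / 2) (v : VermaPlus μ) :
    denseToVermaMinus hμ hq (vermaPlusToDense hq v) = 0 := by
  have h : ((denseToVermaMinus hμ hq).comp (vermaPlusToDense hq)).ker = ⊤ := by
    refine eq_top_of_single_mem _ _ fun n t => ?_
    change reindex _ _ (reindex _ _ (Finsupp.single n t)) = 0
    rw [reindex_single, reindex_single, if_neg (by omega), zero_mul, Finsupp.single_zero]
  exact (h ▸ LieSubmodule.mem_top v : v ∈ ((denseToVermaMinus hμ hq).comp _).ker)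

theorem vermaMinusToLinked_injective (μ : ℂ) : Function.Injective (vermaMinusToLinked μ) :=
  reindex_injective ((add_left_injective 1).comp Nat.cast_injective) fun _ => one_ne_zero

theorem linkedToVermaPlus_surjective (μ : ℂ) : Function.Surjective (linkedToVermaPlus μ) :=
  reindex_surjective fun n => ⟨-n, by omega, by rw [if_pos (by omega)]; exact one_ne_zero⟩

theorem toEnd_sl2f_dense_injective (μ q : ℂ) :
    Function.Injective (LieModule.toEnd ℂ Sl2 (Dense μ q) sl2f) := by
  have h : Function.Injective (denseRep μ q).F :=
    reindex_injective (sub_left_injective (b := (1 : ℤ))) fun _ => one_ne_zero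
  intro v v' hv
  change (denseRep μ q).act sl2f v = (denseRep μ q).act sl2f v' at hv
  rw [Sl2Rep.act_sl2f] at hv
  exact h hv

theorem toEnd_sl2e_linked_injective (hμ : ∀ n : ℤ, μ ≠ n) :
    Function.Injective (LieModule.toEnd ℂ Sl2 (linkedRep μ).Mod sl2e) := by
  have h : Function.Injective (linkedRep μ).E := by
    refine reindex_injective (add_left_injective (1 : ℤ)) fun j => ?_
    rw [linkedUp]
    split_ifs with hj
    · refine mul_ne_zero (neg_ne_zero.mpr (Int.cast_ne_zero.mpr hj.ne)) fun h => ?_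
      exact hμ (-(j + 1)) (by push_cast; linear_combination h)
    · exact one_ne_zero
  intro v v' hv
  change (linkedRep μ).act sl2e v = (linkedRep μ).act sl2e v' at hv
  rw [Sl2Rep.act_sl2e] at hv
  exact h hv

theorem exists_pow_sl2f_mem_range {q : ℂ} (hq : q = μ * (μ + 2) / 2) (v : Dense μ q) :
    ∃ n, (LieModule.toEnd ℂ Sl2 (Dense μ q) sl2f ^ n) v ∈ (vermaPlusToDense hq).range := by
  have h : saturation (vermaPlusToDense hq).range ad_sl2f = ⊤ := by
    -- After `j.toNat` steps down the index is at most `0`, where the highest-weight Verma module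
    -- sits.
    refine eq_top_of_single_mem _ _ fun j t => ⟨j.toNat, ?_⟩
    rw [toEnd_toMod_pow, Sl2Rep.act_sl2f]
    have hF (n : ℕ) : ((denseRep μ q).F ^ n) (Finsupp.single j t) = Finsupp.single (j - n) t := by
      induction n with
      | zero => simp
      | succ n ih =>
        rw [pow_succ', Module.End.mul_apply, ih, denseRep, shiftEnd_single, one_mul]
        push_cast; rw [sub_sub]
    rw [hF]
    refine ⟨(vermaPlusRep μ).toMod (Finsupp.single (j.toNat - j).toNat t), ?_⟩
    change reindex _ _ (Finsupp.single (j.toNat - j).toNat t) = Finsupp.single (j - j.toNat) t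
    rw [reindex_single, one_mul]
    congr 1
    omega
  exact mem_saturation.mp (h ▸ LieSubmodule.mem_top v)

theorem exists_pow_sl2e_mem_range (v : (linkedRep μ).Mod) :
    ∃ n, (LieModule.toEnd ℂ Sl2 (linkedRep μ).Mod sl2e ^ n) v ∈ (vermaMinusToLinked μ).range := by
  have h : saturation (vermaMinusToLinked μ).range ad_sl2e = ⊤ := by
    -- After this many steps up the index is at least `1`, where the lowest-weight Verma module
    -- sits. The coefficient acquired on the way does not matter.
    refine eq_top_of_single_mem _ _ fun j t => ⟨(1 - j).toNat, ?_⟩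
    rw [toEnd_toMod_pow, Sl2Rep.act_sl2e]
    have hE (n : ℕ) : ∃ t', ((linkedRep μ).E ^ n) (Finsupp.single j t) =
        Finsupp.single (j + n) t' := by
      induction n with
      | zero => exact ⟨t, by simp⟩
      | succ n ih =>
        obtain ⟨t', ht'⟩ := ih
        refine ⟨linkedUp μ (j + n) * t', ?_⟩
        rw [pow_succ', Module.End.mul_apply, ht', linkedRep, shiftEnd_single]
        push_cast; rw [add_assoc]
    obtain ⟨t', ht'⟩ := hE (1 - j).toNat
    rw [ht']
    refine ⟨(vermaMinusRep (μ + 2)).toMod (Finsupp.single (j + (1 - j).toNat - 1).toNat t'), ?_⟩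
    change reindex _ _ (Finsupp.single (j + (1 - j).toNat - 1).toNat t') =
      Finsupp.single (j + (1 - j).toNat) t'
    rw [reindex_single, one_mul]
    congr 1
    omega
  exact mem_saturation.mp (h ▸ LieSubmodule.mem_top v)

open RelaxedVerma

/-- For every level and conformal weight, and every nonintegral weight `μ`, the relaxed module
`E_{μ; q}` with `q = (μ, μ + 2ρ)` is a nonsplit extension of `L⁻_{μ + α}` by `L⁺_μ`. -/
theorem relaxedE_extension (k Δ : ℂ) {q : ℂ} (hμ : ∀ n : ℤ, μ ≠ n) (hq : q = μ * (μ + 2) / 2) :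
    LieModule.IsIrreducible ℂ AffineSl2 (LPlus k Δ μ) ∧
    LieModule.IsIrreducible ℂ AffineSl2 (LMinus k Δ (μ + 2)) ∧
    ∃ (ι : LPlus k Δ μ →ₗ⁅ℂ, AffineSl2⁆ RelaxedE k Δ μ q)
      (π : RelaxedE k Δ μ q →ₗ⁅ℂ, AffineSl2⁆ LMinus k Δ (μ + 2)),
      Function.Injective ι ∧ Function.Exact ι π ∧ Function.Surjective π ∧
      ¬ ∃ σ : LMinus k Δ (μ + 2) →ₗ⁅ℂ, AffineSl2⁆ RelaxedE k Δ μ q, ∀ x, π (σ x) = x := by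
  obtain ⟨PX, hPX⟩ := isWeightDecomp_vermaPlus μ
  obtain ⟨PZ, hPZ⟩ := isWeightDecomp_vermaMinus μ
  obtain ⟨PE, hPE⟩ := isWeightDecomp_dense μ q
  obtain ⟨PE', hPE'⟩ := isWeightDecomp_linked μ
  have hsX := VermaPlus.eq_bot_or_eq_top hμ
  have hsZ := VermaMinus.eq_bot_or_eq_top (μ := μ + 2) fun n h =>
    hμ (n - 2) (by push_cast; linear_combination h)
  have rX := isTopRadical_maxProper (k := k) (Δ := Δ) isGroundMap_ofBase generates_ofBase
    (ofBase_injective k Δ (VermaPlus μ)) hPX hsX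
  have rZ := isTopRadical_maxProper (k := k) (Δ := Δ) isGroundMap_ofBase generates_ofBase
    (ofBase_injective k Δ (VermaMinus (μ + 2))) hPZ hsZ
  have rE := isTopRadical_groundRadical (k := k) (Δ := Δ) isGroundMap_ofBase generates_ofBase
    (ofBase_injective k Δ (Dense μ q)) hPE
  have rE' := isTopRadical_groundRadical (k := k) (Δ := Δ) isGroundMap_ofBase generates_ofBase
    (ofBase_injective k Δ (linkedRep μ).Mod) hPE'
  have tX := isTopModule_quotBase isGroundMap_ofBase generates_ofBase
    (ofBase_injective k Δ (VermaPlus μ)) rX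
  have tZ := isTopModule_quotBase isGroundMap_ofBase generates_ofBase
    (ofBase_injective k Δ (VermaMinus (μ + 2))) rZ
  have tE := isTopModule_quotBase isGroundMap_ofBase generates_ofBase
    (ofBase_injective k Δ (Dense μ q)) rE
  have tE' := isTopModule_quotBase isGroundMap_ofBase generates_ofBase
    (ofBase_injective k Δ (linkedRep μ).Mod) rE'
  obtain ⟨ι, hι⟩ := exists_quotMap hPX hPE rX tE (vermaPlusToDense hq)
  obtain ⟨π, hπ⟩ := exists_quotMap hPE hPZ rE tZ (denseToVermaMinus hμ hq)
  -- The opposite extension is auxiliary: it serves to bound multiplicities of `L⁺` by those of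
  -- `L⁻`.
  obtain ⟨ι', hι'⟩ := exists_quotMap hPZ hPE' rZ tE' (vermaMinusToLinked μ)
  obtain ⟨π', hπ'⟩ := exists_quotMap hPE' hPX rE' tX (linkedToVermaPlus μ)
  have iι := injective_of_base tX tE.inj hι (vermaPlusToDense_injective hq)
  have iι' := injective_of_base tZ tE'.inj hι' (vermaMinusToLinked_injective μ)
  have sπ := surjective_of_base tZ.gen hπ (denseToVermaMinus_surjective hμ hq)
  have sπ' := surjective_of_base tX.gen hπ' (linkedToVermaPlus_surjective μ)
  have hf := injective_toEnd_of_ground tE ad_mode_zero_sl2f (toEnd_sl2f_dense_injective μ q)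
  have he := injective_toEnd_of_ground tE' ad_mode_zero_sl2e (toEnd_sl2e_linked_injective hμ)
  have hfE := exists_pow_mem_of_ground tE.ground tE.gen ad_mode_zero_sl2f ι.range fun v => by
    obtain ⟨n, x, hx⟩ := exists_pow_sl2f_mem_range hq v
    exact ⟨n, _, by rw [hι, ← hx]⟩
  have heE' := exists_pow_mem_of_ground tE'.ground tE'.gen ad_mode_zero_sl2e ι'.range fun v => by
    obtain ⟨n, x, hx⟩ := exists_pow_sl2e_mem_range v
    exact ⟨n, _, by rw [hι', ← hx]⟩
  refine ⟨isIrreducible_of_isTopModule tX hsX, isIrreducible_of_isTopModule tZ hsZ, ι, π, iι,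
    fun w => ⟨fun hw => ?_, ?_⟩, sπ, ?_⟩
  · exact ker_le_range hμ (tX.isWeightModule hPX) (tE.isWeightModule hPE) (tZ.isWeightModule hPZ)
      (tE'.isWeightModule hPE') iι sπ iι' sπ' hf he hfE heE' hw
  · rintro ⟨x, rfl⟩
    refine tX.gen.hom_ext (g := π.comp ι) (g' := 0) (fun v => ?_) x
    rw [LieModuleHom.comp_apply, hι, hπ, denseToVermaMinus_vermaPlusToDense, map_zero]
    rfl
  · rintro ⟨σ, hσ⟩
    -- A section would send this lowest-weight vector to one annihilated by `f`, which acts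
    -- injectively on `E`.
    let v : VermaMinus (μ + 2) := (vermaMinusRep (μ + 2)).toMod (Finsupp.single 0 1)
    have hv : ⁅sl2f, v⁆ = 0 := by
      change (vermaMinusRep (μ + 2)).act sl2f (Finsupp.single 0 1) = 0
      rw [Sl2Rep.act_sl2f, vermaMinusRep, shiftEnd_single]
      simp
    have h1 : ⁅mode 0 sl2f, σ (quotBase (ofBase k Δ _) (maxProper _) v)⁆ = 0 := by
      rw [← LieModuleHom.map_lie, tZ.ground.zero_mode, hv, map_zero, map_zero]
    have h2 := (injective_iff_map_eq_zero _).mp hf _ h1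
    have h3 := hσ (quotBase (ofBase k Δ _) (maxProper _) v)
    rw [h2, map_zero] at h3
    have h4 : v = 0 := (injective_iff_map_eq_zero _).mp tZ.inj v h3.symm
    have h5 : (Finsupp.single 0 1 : ℕ →₀ ℂ) = 0 := h4
    simp at h5

end Main

/-- Integrality would give `v ∣ u s`, hence `v ∣ s` by coprimality, against `1 ≤ s ≤ v - 1`. -/
theorem muRS_ne_intCast {u v r s : ℕ} (huv : Nat.Coprime u v) (hs : 1 ≤ s) (hsv : s ≤ v - 1)
    (n : ℤ) : muRS u v r s ≠ n := by
  intro h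
  have hv : (v : ℂ) ≠ 0 := Nat.cast_ne_zero.mpr (by omega)
  have h1 : (u : ℂ) * s = v * (r - 1 - n) := by
    simp only [muRS, Int.cast_natCast] at h
    field_simp at h
    linear_combination -h
  have h2 : (u : ℤ) * s = v * (r - 1 - n) := by exact_mod_cast h1
  have h3 : (v : ℤ) ∣ (u * s : ℕ) := ⟨_, by rw [Nat.cast_mul, h2]⟩
  have h4 : v ∣ s := (Nat.Coprime.symm huv).dvd_of_dvd_mul_left (Int.natCast_dvd_natCast.mp h3)
  exact absurd (Nat.le_of_dvd hs h4) (by omega)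

end RelaxedSl2

open RelaxedSl2 in
theorem mainTheorem4 (u v r s : ℕ) (hu : 2 ≤ u) (hv : 1 ≤ v) (huv : Nat.Coprime u v)
    (hr : 1 ≤ r) (hru : r ≤ u - 1) (hs : 1 ≤ s) (hsv : s ≤ v - 1)
    (k q Δ : ℂ) (hk : k = level u v) (hq : q = qRS u v r s) (hΔ : Δ = sugawara k q) :
    muRS u v r s + 2 = -muRS u v (u - r) (v - s) ∧
    LieModule.IsIrreducible ℂ AffineSl2 (LPlus k Δ (muRS u v r s)) ∧
    LieModule.IsIrreducible ℂ AffineSl2 (LMinus k Δ (-muRS u v (u - r) (v - s))) ∧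
    ∃ (ι : LPlus k Δ (muRS u v r s) →ₗ⁅ℂ, AffineSl2⁆ RelaxedE k Δ (muRS u v r s) q)
      (π : RelaxedE k Δ (muRS u v r s) q →ₗ⁅ℂ, AffineSl2⁆
        LMinus k Δ (-muRS u v (u - r) (v - s))),
      Function.Injective ι ∧ Function.Exact ι π ∧ Function.Surjective π ∧
      ¬ ∃ σ : LMinus k Δ (-muRS u v (u - r) (v - s)) →ₗ⁅ℂ, AffineSl2⁆
          RelaxedE k Δ (muRS u v r s) q,
        ∀ x, π (σ x) = x := by
  have hv0 : (v : ℂ) ≠ 0 := Nat.cast_ne_zero.mpr (by omega)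
  have h1 : muRS u v r s + 2 = -muRS u v (u - r) (v - s) := by
    simp only [muRS]
    push_cast
    field_simp
    ring
  -- Since `v r - u s = v (μ + 1)`, the value of `q` is `((μ + 1)² - 1) / 2`.
  have hq' : q = muRS u v r s * (muRS u v r s + 2) / 2 := by
    rw [hq]
    simp only [qRS, muRS]
    push_cast
    field_simp
    ring
  rw [← h1]
  exact ⟨rfl, relaxedE_extension k Δ (muRS_ne_intCast huv hs hsv) hq'⟩
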